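/- Let the north hemisphere $S_+=\{y\in S^2\subset\mathbb R^3 : y_3>0\}$ of the Grushin sphere carry the spherical coordinates $(\cos x\cos\phi,\cos x\sin\phi,\sin x)$, $x\in(0,\pi/2)$, $\phi\in\mathbb R/2\pi\mathbb Z$ (singular only at the north pole $x=\pi/2$), the Riemannian metric for which $\partial_x$ and $\tan(x)\,\partial_\phi$ are orthonormal, its volume $d\omega=\frac{1}{\tan x}\,dx\,d\phi$, and its Laplace-Beltrami operator $$\Delta=\partial_x^2-\frac{1}{\sin x\cos x}\,\partial_x+\tan^2(x)\,\partial_\phi^2 .$$ Then $-\Delta$ with domain $C_c^\infty(S_+)$ is essentially self-adjoint in $L^2(S_+,d\omega)$, and its closure, again written $-\Delta$, has purely discrete spectrum (every point of the spectrum is isolated in it and is an eigenvalue of finite multiplicity) $$\sigma(-\Delta)=\sigma_{\mathrm d}(-\Delta)=\{\lambda_{n,k}:=4n(n+|k|) \mid n\in\mathbb N,\ n\ge 1,\ k\in\mathbb Z\}.$$ The corresponding eigenfunctions are $$\psi_{n,k}(x,\phi)=e^{ik(\phi+\frac{\pi}{2})}\,\cos(x)^{|k|}\,F\bigl(-n,\;n+|k|;\;1+|k|;\;\cos(x)^2\bigr),\qquad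 n\ge1,\ k\in\mathbb Z,$$ where $F(a,b;c;z)$ is the Gauss hypergeometric function (here a polynomial in $\cos^2x$): each $\psi_{n,k}$ is an eigenfunction of $-\Delta$ with eigenvalue $\lambda_{n,k}$, and every eigenspace of $-\Delta$ is spanned by the $\psi_{n,k}$ that belong to its eigenvalue. -/

import Mathlib

open Real Set Filter Topology MeasureTheory
open scoped ContDiff Manifold

/-! ### Spectral notions for unbounded operators on a Hilbert space -/

section Spectral

variable {H : Type*} [NormedAddCommGroup H] [InnerProductSpace ℂ H]

/-- `z` is in the resolvent set of the operator `T` if `T - z`, from the domain of `T` to `H`, is a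
bijection with a bounded inverse `R`. -/
def IsResolventPoint (T : H →ₗ.[ℂ] H) (z : ℂ) : Prop :=
  ∃ R : H →L[ℂ] H,
    (∀ v : H, ∃ h : R v ∈ T.domain, T ⟨R v, h⟩ - z • R v = v) ∧
      ∀ u : T.domain, R (T u - z • (u : H)) = u

/-- The spectrum of `T`: the complement of its resolvent set. -/
def operatorSpectrum (T : H →ₗ.[ℂ] H) : Set ℂ := {z | ¬ IsResolventPoint T z}

/-- The space of all `u` in the domain of `T` with `T u = z u`. -/
def operatorEigenspace (T : H →ₗ.[ℂ] H) (z : ℂ) : Submodule ℂ H where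
  carrier := {u | ∃ h : u ∈ T.domain, T ⟨u, h⟩ = z • u}
  zero_mem' := ⟨T.domain.zero_mem, by
    have : (⟨0, T.domain.zero_mem⟩ : T.domain) = 0 := rfl
    rw [this, T.map_zero, smul_zero]⟩
  add_mem' := by
    rintro u v ⟨hu, hu'⟩ ⟨hv, hv'⟩
    refine ⟨T.domain.add_mem hu hv, ?_⟩
    have : (⟨u + v, T.domain.add_mem hu hv⟩ : T.domain) = ⟨u, hu⟩ + ⟨v, hv⟩ := rfl
    rw [this, T.map_add, hu', hv', smul_add]
  smul_mem' := by
    rintro c u ⟨hu, hu'⟩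
    refine ⟨T.domain.smul_mem c hu, ?_⟩
    have : (⟨c • u, T.domain.smul_mem c hu⟩ : T.domain) = c • ⟨u, hu⟩ := rfl
    rw [this, T.map_smul, hu', smul_comm]

/-- The discrete spectrum of `T`: the isolated points of the spectrum that are eigenvalues of
finite multiplicity. -/
def operatorDiscreteSpectrum (T : H →ₗ.[ℂ] H) : Set ℂ :=
  {z | z ∈ operatorSpectrum T ∧ (∃ ε > 0, Metric.ball z ε ∩ operatorSpectrum T = {z}) ∧
    operatorEigenspace T z ≠ ⊥ ∧ FiniteDimensional ℂ (operatorEigenspace T z)}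

end Spectral

/-! ### The north hemisphere of the Grushin sphere -/

/-- The unit sphere of `ℝ³`, with the smooth structure of Mathlib. -/
abbrev UnitSphere : Type := Metric.sphere (0 : EuclideanSpace ℝ (Fin 3)) 1

/-- The open north hemisphere `S₊`, a connected component of the complement of the
singular set `{y₃ = 0}`; it contains the north pole. -/
def northHemisphere : Set UnitSphere := {q | 0 < (q : EuclideanSpace ℝ (Fin 3)) 2}

/-- The point `(cos x cos φ, cos x sin φ, sin x)` of the sphere with latitude `x` and longitude
`φ`, for `p = (x, φ)`. -/
noncomputable def sphericalPoint (p : ℝ × ℝ) : UnitSphere :=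
  ⟨!₂[cos p.1 * cos p.2, cos p.1 * sin p.2, sin p.1], by
    rw [mem_sphere_zero_iff_norm, EuclideanSpace.norm_eq, Real.sqrt_eq_one]
    simp only [Fin.sum_univ_three, Real.norm_eq_abs, sq_abs]
    simp
    nlinarith [sin_sq_add_cos_sq p.1, sin_sq_add_cos_sq p.2]⟩

/-- The latitude `x ∈ [-π/2, π/2]` and longitude `φ ∈ (-π, π]` of a point of the sphere. -/
noncomputable def sphericalCoord (q : UnitSphere) : ℝ × ℝ :=
  (arcsin ((q : EuclideanSpace ℝ (Fin 3)) 2),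
    Complex.arg ⟨(q : EuclideanSpace ℝ (Fin 3)) 0, (q : EuclideanSpace ℝ (Fin 3)) 1⟩)

/-- The coordinate rectangle; its image under `sphericalPoint` is `S₊` up to a meridian. -/
def coordRectangle : Set (ℝ × ℝ) := Ioo 0 (π / 2) ×ˢ Ioo (-π) π

/-- The Riemannian volume `dω = dx dφ / |tan x|` of the Grushin metric on `S₊`, as a measure on the
sphere that is concentrated on `S₊`. -/
noncomputable def grushinVolume : Measure UnitSphere :=
  ((volume.restrict coordRectangle).withDensity
    fun p : ℝ × ℝ => ENNReal.ofReal (1 / |tan p.1|)).map sphericalPoint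

/-- The Hilbert space `L²(S₊, dω)` of complex functions. -/
abbrev GrushinL2 : Type := Lp ℂ 2 grushinVolume

/-- The coordinate expression
`∂ₓ² u - (1 / (sin x cos x)) ∂ₓ u + tan² x ∂_φ² u` of the Laplace-Beltrami operator. -/
noncomputable def coordLaplacian (u : ℝ × ℝ → ℂ) (p : ℝ × ℝ) : ℂ :=
  iteratedDeriv 2 (fun x => u (x, p.2)) p.1
    - ((1 / (sin p.1 * cos p.1) : ℝ) : ℂ) * deriv (fun x => u (x, p.2)) p.1
    + ((tan p.1 ^ 2 : ℝ) : ℂ) * iteratedDeriv 2 (fun φ => u (p.1, φ)) p.2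

/-- The Laplace-Beltrami operator `Δ` of the Grushin sphere applied to a function `f`. (At the north
pole, a null set, the coordinates are singular and the value is irrelevant.) -/
noncomputable def grushinLaplacianFun (f : UnitSphere → ℂ) (q : UnitSphere) : ℂ :=
  coordLaplacian (fun p => f (sphericalPoint p)) (sphericalCoord q)

/-- `C_c^∞(S₊)`: smooth functions on the sphere with (compact) support in `S₊`. -/
def IsHemisphereTestFunction (f : UnitSphere → ℂ) : Prop :=
  ContMDiff (𝓡 2) 𝓘(ℝ, ℂ) ∞ f ∧ tsupport f ⊆ northHemisphere

theorem contMDiff_sphericalPoint : ContMDiff 𝓘(ℝ, ℝ × ℝ) (𝓡 2) ∞ sphericalPoint := by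
  have := Fact.mk (@finrank_euclideanSpace_fin ℝ _ 3)
  refine ContMDiff.codRestrict_sphere (n := 2)
    (f := fun p : ℝ × ℝ => !₂[cos p.1 * cos p.2, cos p.1 * sin p.2, sin p.1]) ?_ _
  rw [contMDiff_iff_contDiff, contDiff_euclidean]
  intro i
  fin_cases i
  · exact (contDiff_cos.comp contDiff_fst).mul (contDiff_cos.comp contDiff_snd)
  · exact (contDiff_cos.comp contDiff_fst).mul (contDiff_sin.comp contDiff_snd)
  · exact contDiff_sin.comp contDiff_fst

theorem IsHemisphereTestFunction.contDiff {f : UnitSphere → ℂ}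
    (hf : IsHemisphereTestFunction f) : ContDiff ℝ ∞ fun p => f (sphericalPoint p) :=
  contMDiff_iff_contDiff.1 (hf.1.comp contMDiff_sphericalPoint)

theorem coordLaplacian_add {u v : ℝ × ℝ → ℂ} (hu : ContDiff ℝ ∞ u) (hv : ContDiff ℝ ∞ v)
    (p : ℝ × ℝ) :
    coordLaplacian (fun p => u p + v p) p = coordLaplacian u p + coordLaplacian v p := by
  have h1 : ∀ {w : ℝ × ℝ → ℂ}, ContDiff ℝ ∞ w → ContDiff ℝ ∞ fun x => w (x, p.2) :=
    fun hw => hw.comp (contDiff_id.prodMk contDiff_const)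
  have h2 : ∀ {w : ℝ × ℝ → ℂ}, ContDiff ℝ ∞ w → ContDiff ℝ ∞ fun φ => w (p.1, φ) :=
    fun hw => hw.comp (contDiff_const.prodMk contDiff_id)
  have le2 : ((2 : ℕ) : ℕ∞ω) ≤ ∞ := WithTop.coe_le_coe.2 (le_top : ((2 : ℕ) : ℕ∞) ≤ ⊤)
  unfold coordLaplacian
  rw [iteratedDeriv_fun_add ((h1 hu).of_le le2).contDiffAt ((h1 hv).of_le le2).contDiffAt,
    iteratedDeriv_fun_add ((h2 hu).of_le le2).contDiffAt ((h2 hv).of_le le2).contDiffAt,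
    deriv_fun_add ((h1 hu).differentiable (by simp) _) ((h1 hv).differentiable (by simp) _)]
  ring

theorem coordLaplacian_mul (c : ℂ) {u : ℝ × ℝ → ℂ} (hu : ContDiff ℝ ∞ u) (p : ℝ × ℝ) :
    coordLaplacian (fun p => c * u p) p = c * coordLaplacian u p := by
  have h1 : ContDiff ℝ ∞ fun x => u (x, p.2) := hu.comp (contDiff_id.prodMk contDiff_const)
  have h2 : ContDiff ℝ ∞ fun φ => u (p.1, φ) := hu.comp (contDiff_const.prodMk contDiff_id)
  have le2 : ((2 : ℕ) : ℕ∞ω) ≤ ∞ := WithTop.coe_le_coe.2 (le_top : ((2 : ℕ) : ℕ∞) ≤ ⊤)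
  unfold coordLaplacian
  rw [iteratedDeriv_const_mul c (h1.of_le le2).contDiffAt,
    iteratedDeriv_const_mul c (h2.of_le le2).contDiffAt,
    deriv_const_mul c (h1.differentiable (by simp) _)]
  ring

/-- The graph of `-Δ` on `C_c^∞(S₊)` (it is indeed a graph, see below): the pairs `(u, v)` in `L²(S₊, dω)` such that `u` is the class of
a test function `f` and `v` is the class of `-Δ f`. -/
def grushinCoreGraph : Submodule ℂ (GrushinL2 × GrushinL2) where
  carrier := {w | ∃ f, IsHemisphereTestFunction f ∧ w.1 =ᵐ[grushinVolume] f ∧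
    w.2 =ᵐ[grushinVolume] fun q => -grushinLaplacianFun f q}
  zero_mem' := by
    refine ⟨fun _ => 0, ⟨contMDiff_const, by simp [tsupport]⟩, Lp.coeFn_zero _ _ _, ?_⟩
    have : ∀ q, -grushinLaplacianFun (fun _ => 0) q = 0 := by
      intro q; simp [grushinLaplacianFun, coordLaplacian]
    simp only [this]
    exact Lp.coeFn_zero _ _ _
  add_mem' := by
    rintro w w' ⟨f, hf, hf1, hf2⟩ ⟨g, hg, hg1, hg2⟩
    refine ⟨fun q => f q + g q, ⟨hf.1.add hg.1, (tsupport_add f g).trans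
      (union_subset hf.2 hg.2)⟩, ?_, ?_⟩
    · filter_upwards [Lp.coeFn_add w.1 w'.1, hf1, hg1] with q h h1 h2
      rw [Prod.fst_add, h, Pi.add_apply, h1, h2]
    · filter_upwards [Lp.coeFn_add w.2 w'.2, hf2, hg2] with q h h1 h2
      rw [Prod.snd_add, h, Pi.add_apply, h1, h2]
      simp only [grushinLaplacianFun, coordLaplacian_add hf.contDiff hg.contDiff]
      ring
  smul_mem' := by
    rintro c w ⟨f, hf, hf1, hf2⟩
    refine ⟨fun q => c * f q, ⟨(contDiff_const.mul contDiff_id).contMDiff.comp hf.1,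
      (tsupport_smul_subset_right (fun _ => c) f).trans hf.2⟩, ?_, ?_⟩
    · filter_upwards [Lp.coeFn_smul c w.1, hf1] with q h h1
      rw [Prod.smul_fst, h, Pi.smul_apply, h1, smul_eq_mul]
    · filter_upwards [Lp.coeFn_smul c w.2, hf2] with q h h1
      rw [Prod.smul_snd, h, Pi.smul_apply, h1, smul_eq_mul]
      simp only [grushinLaplacianFun, coordLaplacian_mul c hf.contDiff]
      ring

/-- The operator `-Δ` with domain `C_c^∞(S₊)`. -/
noncomputable def grushinCore : GrushinL2 →ₗ.[ℂ] GrushinL2 := grushinCoreGraph.toLinearPMap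

theorem sphericalCoord_sphericalPoint {p : ℝ × ℝ} (hp : p ∈ coordRectangle) :
    sphericalCoord (sphericalPoint p) = p := by
  obtain ⟨⟨h1, h2⟩, h3, h4⟩ := hp
  have hc : 0 < cos p.1 := cos_pos_of_mem_Ioo ⟨by linarith [pi_pos], h2⟩
  refine Prod.ext ?_ ?_
  · simpa [sphericalCoord, sphericalPoint] using arcsin_sin (by linarith [pi_pos]) h2.le
  · have : (⟨cos p.1 * cos p.2, cos p.1 * sin p.2⟩ : ℂ)
        = (cos p.1 : ℝ) * (Complex.cos p.2 + Complex.sin p.2 * Complex.I) := by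
      apply Complex.ext <;>
        simp [← Complex.ofReal_cos, ← Complex.ofReal_sin]
    simp only [sphericalCoord, sphericalPoint]
    simp only [Matrix.cons_val_zero, Matrix.cons_val_one]
    rw [this]
    exact Complex.arg_mul_cos_add_sin_mul_I hc ⟨h3, h4.le⟩

theorem ae_coord_iff {P : ℝ × ℝ → Prop} :
    (∀ᵐ p ∂((volume.restrict coordRectangle).withDensity
      fun p : ℝ × ℝ => ENNReal.ofReal (1 / |tan p.1|)), P p) ↔
      ∀ᵐ p ∂(volume.restrict coordRectangle), P p := by
  have hm : Measurable fun p : ℝ × ℝ => ENNReal.ofReal (1 / |tan p.1|) := by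
    have : Measurable tan := by
      have : tan = fun x => sin x / cos x := funext tan_eq_sin_div_cos
      rw [this]
      exact measurable_sin.div measurable_cos
    fun_prop
  rw [ae_withDensity_iff hm]
  have hr : ∀ᵐ p ∂(volume.restrict coordRectangle), p ∈ coordRectangle :=
    ae_restrict_mem (measurableSet_Ioo.prod measurableSet_Ioo)
  refine ⟨fun h => ?_, fun h => h.mono fun p hp _ => hp⟩
  filter_upwards [h, hr] with p hp hpr
  refine hp ?_
  have : 0 < tan p.1 := tan_pos_of_pos_of_lt_pi_div_two hpr.1.1 hpr.1.2
  simp only [ne_eq, ENNReal.ofReal_eq_zero, not_le]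
  positivity

theorem ae_coord_of_ae_grushinVolume {P : UnitSphere → Prop} (h : ∀ᵐ q ∂grushinVolume, P q) :
    ∀ᵐ p ∂(volume.restrict coordRectangle), P (sphericalPoint p) :=
  ae_coord_iff.1 (ae_of_ae_map contMDiff_sphericalPoint.continuous.measurable.aemeasurable h)

theorem ae_grushinVolume_of_ae_coord {P : UnitSphere → Prop} (hP : MeasurableSet {q | P q})
    (h : ∀ᵐ p ∂(volume.restrict coordRectangle), P (sphericalPoint p)) :
    ∀ᵐ q ∂grushinVolume, P q :=
  (ae_map_iff contMDiff_sphericalPoint.continuous.measurable.aemeasurable hP).2 (ae_coord_iff.2 h)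

/-- `-Δ f` depends only on the class of `f`, so that `grushinCoreGraph` is a graph. -/
theorem grushinCoreGraph_snd_eq_zero (w : GrushinL2 × GrushinL2) (hw : w ∈ grushinCoreGraph)
    (h0 : w.1 = 0) : w.2 = 0 := by
  obtain ⟨f, hf, h1, h2⟩ := hw
  have hopen : IsOpen coordRectangle := isOpen_Ioo.prod isOpen_Ioo
  have hf0 : ∀ᵐ q ∂grushinVolume, f q = 0 := by
    rw [h0] at h1
    filter_upwards [h1, Lp.coeFn_zero ℂ 2 grushinVolume] with q ha hb
    rw [← ha, hb, Pi.zero_apply]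
  replace hf0 := ae_coord_of_ae_grushinVolume hf0
  have hz : EqOn (fun p => f (sphericalPoint p)) (fun _ => 0) coordRectangle :=
    Measure.eqOn_open_of_ae_eq hf0 hopen hf.contDiff.continuous.continuousOn continuousOn_const
  have hlap : ∀ p ∈ coordRectangle, grushinLaplacianFun f (sphericalPoint p) = 0 := by
    intro p hp
    have e : (fun p => f (sphericalPoint p)) =ᶠ[𝓝 p] fun _ => 0 :=
      hz.eventuallyEq_of_mem (hopen.mem_nhds hp)
    have e1 : (fun x => f (sphericalPoint (x, p.2))) =ᶠ[𝓝 p.1] fun _ => 0 :=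
      (Continuous.prodMk_left p.2).continuousAt.eventually e
    have e2 : (fun φ => f (sphericalPoint (p.1, φ))) =ᶠ[𝓝 p.2] fun _ => 0 :=
      (Continuous.prodMk_right p.1).continuousAt.eventually e
    rw [grushinLaplacianFun, sphericalCoord_sphericalPoint hp, coordLaplacian,
      e1.iteratedDeriv_eq, e2.iteratedDeriv_eq, e1.deriv_eq]
    simp
  obtain ⟨g, hg, hgw⟩ := Lp.aestronglyMeasurable w.2
  have hg0 : ∀ᵐ q ∂grushinVolume, g q = 0 := by
    refine ae_grushinVolume_of_ae_coord (hg.measurable (measurableSet_singleton 0)) ?_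
    have hr : ∀ᵐ p ∂(volume.restrict coordRectangle), p ∈ coordRectangle :=
      ae_restrict_mem (measurableSet_Ioo.prod measurableSet_Ioo)
    filter_upwards [ae_coord_of_ae_grushinVolume (h2.symm.trans hgw), hr] with p hp hpr
    rw [← hp, hlap p hpr, neg_zero]
  refine Lp.ext ?_
  filter_upwards [hgw, hg0, Lp.coeFn_zero ℂ 2 grushinVolume] with q ha hb hc
  rw [ha, hb, hc, Pi.zero_apply]

theorem grushinCore_graph : grushinCore.graph = grushinCoreGraph :=
  Submodule.toLinearPMap_graph_eq _ grushinCoreGraph_snd_eq_zero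

/-- The operator `-Δ` on `L²(S₊, dω)`: the closure of `-Δ` on `C_c^∞(S₊)`. -/
noncomputable def grushinOperator : GrushinL2 →ₗ.[ℂ] GrushinL2 := grushinCore.closure

/-- `λ_{n,k} = 4 n (n + |k|)`. -/
noncomputable def grushinEigenvalue (n : ℕ) (k : ℤ) : ℝ := 4 * n * (n + |(k : ℝ)|)

/-- `ψ_{n,k}(x, φ) = e^{i k (φ + π/2)} (cos x)^{|k|} F(-n, n + |k|; 1 + |k|; cos² x)`. -/
noncomputable def grushinEigenfunction (n : ℕ) (k : ℤ) (q : UnitSphere) : ℂ :=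
  Complex.exp (Complex.I * k * ((sphericalCoord q).2 + π / 2)) *
    ((cos (sphericalCoord q).1 ^ k.natAbs *
      ordinaryHypergeometric (-(n : ℝ)) (n + |(k : ℝ)|) (1 + |(k : ℝ)|)
        (cos (sphericalCoord q).1 ^ 2) : ℝ) : ℂ)

/-!
# The spectrum of the Grushin hemisphere

In the variable `z = cos x · e ^ (i φ)`, the vertical projection of the hemisphere to the unit disk, the
Laplace-Beltrami operator is `(1 - |z|²)` times the flat Laplacian and the volume is the flat area
divided by `1 - |z|²`. The functions `ψ_{n,k}` are polynomials in `z` and its conjugate which, for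
`n ≥ 1`, vanish on the unit circle: the hypergeometric equation at `1` gives `F(-n, n + K; 1 + K; 1) = 0`
(`eval_one_hypergeometricPolynomial`). So they are smooth on the sphere, and square integrable.

The whole statement follows from the fact that the closure of `-Δ` is the maximal multiplication
operator in the Hilbert basis of the normalized `ψ_{n,k}` (`isDiagonalIn_grushinOperator`); for such an
operator with real eigenvalues tending to infinity, self-adjointness, spectrum and eigenspaces are read
off from the coordinates (`IsDiagonalIn`). This fact has three ingredients.

* Symmetry: `⟪ψ, -Δ f⟫ = λ ⟪ψ, f⟫` for every test function `f` (`inner_eigenvector_of_mem_coreGraph`),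
  by integration by parts in the coordinates `(x, φ)`. There are no boundary terms at the pole,
  where `cot x` vanishes.
* Approximation: `(ψ, λ ψ)` lies in the closure of the graph of `-Δ` on test functions
  (`eigenvector_mem_closure`). Here `ψ` is multiplied by a cutoff that is a function of
  `log (sin x) / L`; since `ψ = O(sin² x)`, the error in `-Δ` is `O(1 / L)` on a set of volume `O(L)`,
  and tends to `0` in `L²`. This is why no boundary condition is needed at the equator.
* Totality: only `0` is orthogonal to all `ψ_{n,k}` (`eq_zero_of_inner_eigenvector_eq_zero`). For fixed
  `k` the polynomials `F(-n, n + |k|; 1 + |k|; t) / (1 - t)`, `n ≥ 1`, have all degrees `0, 1, 2, …` and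
  span `ℝ[t]`, so that the `ψ_{n,k}` span `(1 - |z|²) ℂ[z, z̄]`; the Stone-Weierstrass theorem on the
  closed disk then applies.

The `ψ_{n,k}` are orthogonal because for different `k` their frequencies in `φ` differ, and for
equal `k` their eigenvalues do.
-/

/-! ### Operators that are diagonal in a Hilbert basis -/

section Diagonal

variable {H : Type*} [NormedAddCommGroup H] [InnerProductSpace ℂ H] {ι : Type*}

theorem HilbertBasis.ext_inner (b : HilbertBasis ι ℂ H) {u v : H}
    (h : ∀ i, inner ℂ (b i) u = inner ℂ (b i) v) : u = v := by
  apply b.repr.injective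
  ext i
  simpa only [b.repr_apply_apply] using h i

/-- A bounded sequence acts on the coordinates in a Hilbert basis as a bounded operator. -/
theorem HilbertBasis.exists_multiplier (b : HilbertBasis ι ℂ H) (c : ι → ℂ) {C : ℝ}
    (hC : ∀ i, ‖c i‖ ≤ C) :
    ∃ R : H →L[ℂ] H, ∀ v i, inner ℂ (b i) (R v) = c i * inner ℂ (b i) v := by
  have two : (0 : ℝ) < (2 : ENNReal).toReal := by norm_num
  have hsum : ∀ f : lp (fun _ : ι => ℂ) 2, Summable fun i => ‖f i‖ ^ (2 : ENNReal).toReal :=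
    fun f => (memℓp_gen_iff two).1 (lp.memℓp f)
  have hle : ∀ (f : lp (fun _ : ι => ℂ) 2) i, ‖c i * f i‖ ^ (2 : ENNReal).toReal ≤
      |C| ^ (2 : ENNReal).toReal * ‖f i‖ ^ (2 : ENNReal).toReal := by
    intro f i
    rw [← Real.mul_rpow (abs_nonneg _) (norm_nonneg _), norm_mul]
    have := (hC i).trans (le_abs_self C)
    gcongr
  have hmem : ∀ f : lp (fun _ : ι => ℂ) 2, Memℓp (fun i => c i * f i) 2 := by
    intro f
    refine memℓp_gen (Summable.of_nonneg_of_le (fun i => by positivity) (hle f)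
      ((hsum f).mul_left _))
  let M : lp (fun _ : ι => ℂ) 2 →ₗ[ℂ] lp (fun _ : ι => ℂ) 2 :=
    { toFun := fun f => ⟨fun i => c i * f i, hmem f⟩
      map_add' := fun f g => by
        ext i
        exact mul_add _ _ _
      map_smul' := fun a f => by
        ext i
        simp [mul_left_comm] }
  have hM : ∀ f, ‖M f‖ ≤ |C| * ‖f‖ := by
    intro f
    refine lp.norm_le_of_tsum_le two (by positivity) ?_
    rw [Real.mul_rpow (abs_nonneg _) (norm_nonneg _), lp.norm_rpow_eq_tsum two f, ← tsum_mul_left]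
    exact Summable.tsum_le_tsum (hle f) ((memℓp_gen_iff two).1 (hmem f)) ((hsum f).mul_left _)
  refine ⟨b.repr.symm.toContinuousLinearEquiv.toContinuousLinearMap ∘L
    (M.mkContinuous |C| hM) ∘L b.repr.toContinuousLinearEquiv.toContinuousLinearMap, ?_⟩
  intro v i
  rw [← b.repr_apply_apply, ← b.repr_apply_apply]
  simp [M]

/-- If a closed subspace `G` of `H × H` contains all `(bᵢ, lᵢ bᵢ)`, it contains the graph of the
maximal operator that acts on the coordinates in the basis `b` as multiplication by `l`. -/
theorem HilbertBasis.mem_of_inner_eq_mul (b : HilbertBasis ι ℂ H) {l : ι → ℂ}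
    {G : Submodule ℂ (H × H)} (hG : IsClosed (G : Set (H × H)))
    (hb : ∀ i, (b i, l i • b i) ∈ G) {w : H × H}
    (hw : ∀ i, inner ℂ (b i) w.2 = l i * inner ℂ (b i) w.1) : w ∈ G := by
  -- Both components are expanded in the basis; the partial sums lie in `G`.
  have h1 := b.hasSum_repr w.1
  have h2 := b.hasSum_repr w.2
  have h3 : HasSum (fun i => (inner ℂ (b i) w.1 : ℂ) • (b i, l i • b i)) w := by
    convert h1.prodMk h2 using 2 with i
    rw [b.repr_apply_apply, b.repr_apply_apply, hw, Prod.smul_mk, smul_smul, mul_comm]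
  exact hG.mem_of_tendsto h3 (Eventually.of_forall fun s => G.sum_mem fun i _ => G.smul_mem _ (hb i))

variable {T : H →ₗ.[ℂ] H} {b : HilbertBasis ι ℂ H} {l : ι → ℝ}

/-- `T` is the maximal operator that multiplies the `i`-th coordinate in the Hilbert basis `b` by
the real number `l i`. -/
def IsDiagonalIn (T : H →ₗ.[ℂ] H) (b : HilbertBasis ι ℂ H) (l : ι → ℝ) : Prop :=
  ∀ w : H × H, w ∈ T.graph ↔ ∀ i, inner ℂ (b i) w.2 = (l i : ℂ) * inner ℂ (b i) w.1

theorem IsDiagonalIn.basis_mem (hT : IsDiagonalIn T b l) (i : ι) :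
    (b i, (l i : ℂ) • b i) ∈ T.graph := by
  classical
  rw [hT]
  intro j
  simp only [inner_smul_right]
  by_cases h : j = i
  · rw [h]
  · rw [b.orthonormal.2 h]; simp

/-- A pair in the graph of the adjoint can be tested against the basis vectors, so that it satisfies
the equations that define the graph; the converse is Parseval's identity. -/
theorem IsDiagonalIn.isSelfAdjoint [CompleteSpace H] (hT : IsDiagonalIn T b l) : IsSelfAdjoint T := by
  have hdense : Dense (T.domain : Set H) := by
    have := b.dense_span
    rw [← Submodule.dense_iff_topologicalClosure_eq_top] at this
    refine this.mono ?_
    rw [SetLike.coe_subset_coe, Submodule.span_le]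
    rintro _ ⟨i, rfl⟩
    exact LinearPMap.mem_domain_of_mem_graph (hT.basis_mem i)
  rw [LinearPMap.isSelfAdjoint_def]
  apply LinearPMap.eq_of_eq_graph
  rw [LinearPMap.adjoint_graph_eq_graph_adjoint hdense]
  ext w
  rw [Submodule.mem_adjoint_iff, hT]
  constructor
  · intro h i
    have := h _ _ (hT.basis_mem i)
    rw [inner_smul_left, Complex.conj_ofReal, sub_eq_zero] at this
    exact this.symm
  · intro h x y hxy
    rw [hT] at hxy
    rw [sub_eq_zero, ← b.tsum_inner_mul_inner, ← b.tsum_inner_mul_inner]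
    refine tsum_congr fun i => ?_
    rw [h i, ← inner_conj_symm y, hxy i, map_mul, Complex.conj_ofReal, inner_conj_symm]
    ring

/-- Away from the closure of the range of `l`, the resolvent is multiplication by
`(l i - z)⁻¹`. -/
theorem IsDiagonalIn.isResolventPoint (hT : IsDiagonalIn T b l) {z : ℂ} {ε : ℝ} (hε : 0 < ε)
    (h : ∀ i, ε ≤ ‖(l i : ℂ) - z‖) : IsResolventPoint T z := by
  have hne : ∀ i, (l i : ℂ) - z ≠ 0 := fun i => norm_pos_iff.1 (hε.trans_le (h i))
  obtain ⟨R, hR⟩ := b.exists_multiplier (fun i => ((l i : ℂ) - z)⁻¹) (C := ε⁻¹) fun i => by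
    rw [norm_inv]
    exact inv_anti₀ hε (h i)
  refine ⟨R, fun v => ?_, fun u => ?_⟩
  · have hm : (R v, v + z • R v) ∈ T.graph := by
      rw [hT]
      intro i
      simp only [inner_add_right, inner_smul_right, hR]
      have := hne i
      field_simp
      ring
    obtain ⟨y, hy1, hy2⟩ := (LinearPMap.mem_graph_iff T).1 hm
    simp only at hy1 hy2
    refine ⟨hy1 ▸ y.2, ?_⟩
    have : (⟨R v, hy1 ▸ y.2⟩ : T.domain) = y := Subtype.ext hy1.symm
    rw [this, hy2]
    abel
  · refine b.ext_inner fun i => ?_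
    have := (hT _).1 (T.mem_graph u) i
    simp only at this
    rw [hR, inner_sub_right, inner_smul_right, this]
    have := hne i
    field_simp

theorem mem_operatorEigenspace_iff {z : ℂ} {u : H} :
    u ∈ operatorEigenspace T z ↔ (u, z • u) ∈ T.graph := by
  rw [LinearPMap.mem_graph_iff]
  constructor
  · rintro ⟨h, h'⟩
    exact ⟨⟨u, h⟩, rfl, h'⟩
  · rintro ⟨y, hy1, hy2⟩
    simp only at hy1 hy2
    subst hy1
    exact ⟨y.2, hy2⟩

theorem IsDiagonalIn.operatorEigenspace_eq (hT : IsDiagonalIn T b l) {z : ℂ}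
    (hfin : {i | (l i : ℂ) = z}.Finite) :
    operatorEigenspace T z = Submodule.span ℂ (b '' {i | (l i : ℂ) = z}) := by
  classical
  apply le_antisymm
  · intro u hu
    rw [mem_operatorEigenspace_iff, hT] at hu
    have hz : ∀ i ∉ hfin.toFinset, (inner ℂ (b i) u : ℂ) • b i = 0 := by
      intro i hi
      have h1 := hu i
      simp only [inner_smul_right] at h1
      have h2 : (l i : ℂ) ≠ z := by simpa using hi
      have h3 : inner ℂ (b i) u = 0 := by
        by_contra h0
        exact h2 (mul_right_cancel₀ h0 h1).symm
      rw [h3, zero_smul]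
    have h1 := b.hasSum_repr u
    simp only [b.repr_apply_apply] at h1
    rw [h1.unique (hasSum_sum_of_ne_finset_zero hz)]
    refine Submodule.sum_mem _ fun i hi => Submodule.smul_mem _ _ (Submodule.subset_span ⟨i, ?_, rfl⟩)
    simpa using hi
  · rw [Submodule.span_le]
    rintro _ ⟨i, hi, rfl⟩
    rw [SetLike.mem_coe, mem_operatorEigenspace_iff]
    have := hT.basis_mem i
    rwa [show (l i : ℂ) = z from hi] at this

theorem not_isResolventPoint_of_mem_eigenspace {z : ℂ} {u : H} (hu : u ∈ operatorEigenspace T z)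
    (h0 : u ≠ 0) : ¬ IsResolventPoint T z := by
  rintro ⟨R, -, hR⟩
  obtain ⟨h, h'⟩ := hu
  have := hR ⟨u, h⟩
  rw [h', sub_self, map_zero] at this
  exact h0 this.symm

/-- If the real numbers `l i` tend to infinity (each bounded set contains only finitely many, with
multiplicity), every complex number `z` has a punctured neighbourhood that contains none. -/
theorem exists_le_norm_sub_of_finite (hl : ∀ M, {i | |l i| ≤ M}.Finite) (z : ℂ) :
    ∃ ε > 0, ∀ i, (l i : ℂ) ≠ z → ε ≤ ‖(l i : ℂ) - z‖ := by
  classical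
  set S := (hl (‖z‖ + 1)).toFinset.filter fun i => (l i : ℂ) ≠ z with hS
  have far : ∀ i, i ∉ S → (l i : ℂ) ≠ z → 1 ≤ ‖(l i : ℂ) - z‖ := by
    intro i hi hne
    have h1 : ¬ |l i| ≤ ‖z‖ + 1 := fun h => hi (by simp [hS, h, hne])
    have h2 := norm_sub_norm_le (l i : ℂ) z
    rw [Complex.norm_real, Real.norm_eq_abs] at h2
    linarith
  obtain ⟨ε, hε, h⟩ : ∃ ε > 0, ∀ i ∈ S, ε ≤ ‖(l i : ℂ) - z‖ := by
    have hpos : ∀ i ∈ S, 0 < ‖(l i : ℂ) - z‖ := fun i hi =>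
      norm_pos_iff.2 (sub_ne_zero.2 (Finset.mem_filter.1 hi).2)
    rcases S.eq_empty_or_nonempty with h | h
    · exact ⟨1, one_pos, by simp [h]⟩
    · obtain ⟨j, hj, hj'⟩ := S.exists_min_image (fun i => ‖(l i : ℂ) - z‖) h
      exact ⟨_, hpos j hj, hj'⟩
  refine ⟨min ε 1, lt_min hε one_pos, fun i hi => ?_⟩
  by_cases hiS : i ∈ S
  · exact (min_le_left _ _).trans (h i hiS)
  · exact (min_le_right _ _).trans (far i hiS hi)

theorem IsDiagonalIn.operatorSpectrum_eq (hT : IsDiagonalIn T b l)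
    (hl : ∀ M, {i | |l i| ≤ M}.Finite) :
    operatorSpectrum T = range fun i => (l i : ℂ) := by
  ext z
  constructor
  · intro hz
    by_contra hz'
    obtain ⟨ε, hε, h⟩ := exists_le_norm_sub_of_finite hl z
    exact hz (hT.isResolventPoint hε fun i => h i fun hi => hz' ⟨i, hi⟩)
  · rintro ⟨i, rfl⟩
    exact not_isResolventPoint_of_mem_eigenspace
      (mem_operatorEigenspace_iff.2 (hT.basis_mem i)) (b.orthonormal.ne_zero i)

theorem finite_setOf_eq (hl : ∀ M, {i | |l i| ≤ M}.Finite) (z : ℂ) :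
    {i | (l i : ℂ) = z}.Finite := by
  refine (hl ‖z‖).subset fun i (hi : (l i : ℂ) = z) => ?_
  change |l i| ≤ ‖z‖
  rw [← hi, Complex.norm_real, Real.norm_eq_abs]

theorem IsDiagonalIn.operatorDiscreteSpectrum_eq (hT : IsDiagonalIn T b l)
    (hl : ∀ M, {i | |l i| ≤ M}.Finite) :
    operatorDiscreteSpectrum T = operatorSpectrum T := by
  refine Subset.antisymm (fun z hz => hz.1) fun z hz => ⟨hz, ?_, ?_, ?_⟩
  · obtain ⟨ε, hε, h⟩ := exists_le_norm_sub_of_finite hl z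
    refine ⟨ε, hε, Subset.antisymm ?_ ?_⟩
    · rintro w ⟨hw, hw'⟩
      rw [hT.operatorSpectrum_eq hl] at hw'
      obtain ⟨i, rfl⟩ := hw'
      by_contra hne
      exact absurd (h i hne) (not_le.2 (mem_ball_iff_norm.1 hw))
    · rintro _ rfl
      exact ⟨Metric.mem_ball_self hε, hz⟩
  · rw [hT.operatorSpectrum_eq hl] at hz
    obtain ⟨i, rfl⟩ := hz
    exact (Submodule.ne_bot_iff _).2
      ⟨b i, mem_operatorEigenspace_iff.2 (hT.basis_mem i), b.orthonormal.ne_zero i⟩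
  · rw [hT.operatorEigenspace_eq (finite_setOf_eq hl z)]
    exact FiniteDimensional.span_of_finite ℂ ((finite_setOf_eq hl z).image b)

end Diagonal

/-! ### The hypergeometric polynomials -/

section HypergeometricPolynomial

open Polynomial

/-- The polynomial `F(-n, n + K; 1 + K; X)`. -/
noncomputable def hypergeometricPolynomial (n K : ℕ) : ℝ[X] :=
  ∑ j ∈ Finset.range (n + 1),
    monomial j (ordinaryHypergeometricCoefficient (-(n : ℝ)) (n + K) (1 + K) j)

theorem ordinaryHypergeometricCoefficient_eq_zero {n j : ℕ} (h : n < j) (b c : ℝ) :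
    ordinaryHypergeometricCoefficient (-(n : ℝ)) b c j = 0 := by
  have : (ascPochhammer ℝ j).eval (-(n : ℝ)) = 0 :=
    (ascPochhammer_eval_eq_zero_iff j _).2 ⟨n, h, by simp⟩
  simp [ordinaryHypergeometricCoefficient, this]

theorem coeff_hypergeometricPolynomial (n K j : ℕ) :
    (hypergeometricPolynomial n K).coeff j =
      ordinaryHypergeometricCoefficient (-(n : ℝ)) (n + K) (1 + K) j := by
  simp only [hypergeometricPolynomial, finsetSum_coeff, coeff_monomial]
  rw [Finset.sum_ite_eq' (Finset.range (n + 1)) j]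
  split_ifs with h
  · rfl
  · rw [ordinaryHypergeometricCoefficient_eq_zero]
    simpa using h

theorem eval_hypergeometricPolynomial (n K : ℕ) (t : ℝ) :
    (hypergeometricPolynomial n K).eval t =
      ordinaryHypergeometric (-(n : ℝ)) (n + K) (1 + K) t := by
  rw [ordinaryHypergeometric, ordinaryHypergeometric_sum_eq,
    tsum_eq_sum (s := Finset.range (n + 1))]
  · simp [hypergeometricPolynomial, eval_finsetSum, ordinaryHypergeometricCoefficient]
  · intro j hj
    have := ordinaryHypergeometricCoefficient_eq_zero (n := n) (j := j) (by simpa using hj)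
      (n + K) (1 + K)
    rw [ordinaryHypergeometricCoefficient] at this
    rw [this, zero_smul]

theorem ordinaryHypergeometricCoefficient_succ (a b : ℝ) {c : ℝ} (hc : 0 < c) (j : ℕ) :
    ((j : ℝ) + 1) * (c + j) * ordinaryHypergeometricCoefficient a b c (j + 1) =
      (a + j) * (b + j) * ordinaryHypergeometricCoefficient a b c j := by
  have h1 : (ascPochhammer ℝ j).eval c ≠ 0 := (ascPochhammer_pos j c hc).ne'
  have h2 : c + j ≠ 0 := by positivity
  simp only [ordinaryHypergeometricCoefficient, ascPochhammer_succ_eval, Nat.factorial_succ]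
  push_cast
  have h3 : (j.factorial : ℝ) ≠ 0 := by positivity
  field_simp

/-- The hypergeometric differential equation. -/
theorem hypergeometricPolynomial_ode (n K : ℕ) (t : ℝ) :
    t * (1 - t) * (derivative (derivative (hypergeometricPolynomial n K))).eval t +
      (1 + K) * (1 - t) * (derivative (hypergeometricPolynomial n K)).eval t +
      n * (n + K) * (hypergeometricPolynomial n K).eval t = 0 := by
  set P := hypergeometricPolynomial n K with hP
  have key : X * (1 - X) * derivative (derivative P) + C (1 + (K : ℝ)) * (1 - X) * derivative P
      + C ((n : ℝ) * (n + K)) * P = 0 := by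
    have e : X * (1 - X) * derivative (derivative P) + C (1 + (K : ℝ)) * (1 - X) * derivative P
      + C ((n : ℝ) * (n + K)) * P = X * derivative (derivative P)
        - X * (X * derivative (derivative P)) + C (1 + (K : ℝ)) * derivative P
        - C (1 + (K : ℝ)) * (X * derivative P) + C ((n : ℝ) * (n + K)) * P := by ring
    rw [e]
    ext j
    have hr := ordinaryHypergeometricCoefficient_succ (-(n : ℝ)) (n + K)
      (show (0 : ℝ) < 1 + K by positivity) j
    rw [← coeff_hypergeometricPolynomial, ← coeff_hypergeometricPolynomial, ← hP] at hr
    simp only [coeff_add, coeff_sub, coeff_C_mul, coeff_zero]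
    rcases j with _ | _ | j
    · simp [coeff_derivative] at hr ⊢
      linarith
    · simp [coeff_derivative] at hr ⊢
      linarith
    · simp only [coeff_X_mul, coeff_derivative] at hr ⊢
      push_cast at hr ⊢
      linarith
  have := congrArg (eval t) key
  simpa using this

/-- At `t = 1` the differential equation reads `n (n + K) P(1) = 0`. -/
theorem eval_one_hypergeometricPolynomial {n : ℕ} (hn : 1 ≤ n) (K : ℕ) :
    (hypergeometricPolynomial n K).eval 1 = 0 := by
  have h := hypergeometricPolynomial_ode n K 1
  have h1 : (0 : ℝ) < n := by exact_mod_cast hn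
  have h2 : (n : ℝ) * (n + K) ≠ 0 := by positivity
  simpa [h2] using h

theorem degree_hypergeometricPolynomial {n : ℕ} (hn : 1 ≤ n) (K : ℕ) :
    (hypergeometricPolynomial n K).degree = n := by
  apply le_antisymm
  · rw [degree_le_iff_coeff_zero]
    intro m hm
    rw [coeff_hypergeometricPolynomial]
    exact ordinaryHypergeometricCoefficient_eq_zero (by exact_mod_cast hm) _ _
  · apply le_degree_of_ne_zero
    rw [coeff_hypergeometricPolynomial]
    have h1 : (0 : ℝ) < n := by exact_mod_cast hn
    have h2 : (ascPochhammer ℝ n).eval (-(n : ℝ)) ≠ 0 := by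
      rw [Ne, ascPochhammer_eval_eq_zero_iff]
      rintro ⟨k, hk, hk'⟩
      have : (k : ℝ) = n := by simpa using hk'
      exact hk.ne (by exact_mod_cast this)
    have h3 := (ascPochhammer_pos n ((n : ℝ) + K) (by positivity)).ne'
    have h4 := (ascPochhammer_pos n (1 + (K : ℝ)) (by positivity)).ne'
    simp [h2, h3, h4, Nat.factorial_ne_zero]

/-- The polynomial `F(-n, n + K; 1 + K; X) / (1 - X)`, for `n ≥ 1`. -/
noncomputable def reducedPolynomial (n K : ℕ) : ℝ[X] :=
  -(hypergeometricPolynomial n K /ₘ (X - C 1))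

theorem hypergeometricPolynomial_eq {n : ℕ} (hn : 1 ≤ n) (K : ℕ) :
    hypergeometricPolynomial n K = (1 - X) * reducedPolynomial n K := by
  have := mul_divByMonic_eq_iff_isRoot.2 (eval_one_hypergeometricPolynomial hn K)
  rw [map_one] at this
  rw [reducedPolynomial, map_one]
  linear_combination -this

theorem degree_reducedPolynomial (m K : ℕ) : (reducedPolynomial (m + 1) K).degree = m := by
  have hn : 1 ≤ m + 1 := by omega
  have h0 : hypergeometricPolynomial (m + 1) K ≠ 0 := by
    intro h
    have := degree_hypergeometricPolynomial hn K
    rw [h, degree_zero] at this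
    exact WithBot.bot_ne_coe this
  have h1 : natDegree (hypergeometricPolynomial (m + 1) K) = m + 1 :=
    natDegree_eq_of_degree_eq_some (degree_hypergeometricPolynomial hn K)
  have h2 : (1 - X : ℝ[X]).natDegree = 1 := by
    rw [← natDegree_neg, neg_sub]
    exact natDegree_X_sub_C (1 : ℝ)
  rw [hypergeometricPolynomial_eq hn] at h0 h1
  rw [natDegree_mul (left_ne_zero_of_mul h0) (right_ne_zero_of_mul h0), h2] at h1
  rw [degree_eq_natDegree (right_ne_zero_of_mul h0)]
  congr 1
  exact_mod_cast (by omega : natDegree (reducedPolynomial (m + 1) K) = m)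

theorem span_reducedPolynomial (K : ℕ) :
    Submodule.span ℝ (range fun m : ℕ => reducedPolynomial (m + 1) K) = ⊤ := by
  let S : Polynomial.Sequence ℝ := ⟨fun m => reducedPolynomial (m + 1) K,
    fun m => degree_reducedPolynomial m K⟩
  exact S.span fun i => isUnit_iff_ne_zero.2 (leadingCoeff_ne_zero.2 (S.ne_zero i))

end HypergeometricPolynomial

/-! ### The hemisphere as a disk -/

section Disk

theorem contDiff_polynomial_eval (p : Polynomial ℝ) : ContDiff ℝ ∞ fun t => p.eval t := by
  simpa [Polynomial.coe_aeval_eq_eval] using p.contDiff_aeval (𝕜 := ℝ) (R := ℝ) ∞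

/-- The third coordinate of a point of the sphere; it is a defining function of the equator. -/
def height (q : UnitSphere) : ℝ := (q : EuclideanSpace ℝ (Fin 3)) 2

/-- The vertical projection of the sphere to the closed unit disk of `ℂ`. -/
def diskPoint (q : UnitSphere) : ℂ :=
  ⟨(q : EuclideanSpace ℝ (Fin 3)) 0, (q : EuclideanSpace ℝ (Fin 3)) 1⟩

theorem normSq_diskPoint (q : UnitSphere) : ‖diskPoint q‖ ^ 2 = 1 - height q ^ 2 := by
  have h := mem_sphere_zero_iff_norm.1 q.2
  rw [EuclideanSpace.norm_eq, Real.sqrt_eq_one] at h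
  simp only [Fin.sum_univ_three, Real.norm_eq_abs, sq_abs] at h
  rw [← Complex.normSq_eq_norm_sq, Complex.normSq_mk, height, diskPoint]
  linarith

theorem height_sq_le (q : UnitSphere) : height q ^ 2 ≤ 1 := by
  nlinarith [normSq_diskPoint q, sq_nonneg ‖diskPoint q‖]

@[simp] theorem height_sphericalPoint (p : ℝ × ℝ) : height (sphericalPoint p) = sin p.1 := by
  simp [height, sphericalPoint]

theorem contMDiff_coe_unitSphere :
    ContMDiff (𝓡 2) 𝓘(ℝ, EuclideanSpace ℝ (Fin 3)) ∞
      ((↑) : UnitSphere → EuclideanSpace ℝ (Fin 3)) := by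
  have := Fact.mk (@finrank_euclideanSpace_fin ℝ _ 3)
  exact contMDiff_coe_sphere

theorem contMDiff_height : ContMDiff (𝓡 2) 𝓘(ℝ, ℝ) ∞ height := by
  have h : ContDiff ℝ ∞ fun y : EuclideanSpace ℝ (Fin 3) => y 2 := by fun_prop
  exact h.contMDiff.comp contMDiff_coe_unitSphere

theorem contMDiff_diskPoint : ContMDiff (𝓡 2) 𝓘(ℝ, ℂ) ∞ diskPoint := by
  have h : ContDiff ℝ ∞ fun y : EuclideanSpace ℝ (Fin 3) => ((y 0 : ℝ) : ℂ) + (y 1 : ℝ) * Complex.I := by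
    have h0 : ContDiff ℝ ∞ fun y : EuclideanSpace ℝ (Fin 3) => y 0 := by fun_prop
    have h1 : ContDiff ℝ ∞ fun y : EuclideanSpace ℝ (Fin 3) => y 1 := by fun_prop
    exact (Complex.ofRealCLM.contDiff.comp h0).add
      ((Complex.ofRealCLM.contDiff.comp h1).mul contDiff_const)
  have e : diskPoint = (fun y : EuclideanSpace ℝ (Fin 3) =>
      ((y 0 : ℝ) : ℂ) + (y 1 : ℝ) * Complex.I) ∘
        ((↑) : UnitSphere → EuclideanSpace ℝ (Fin 3)) := by
    funext q
    apply Complex.ext <;> simp [diskPoint]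
  rw [e]
  exact h.contMDiff.comp contMDiff_coe_unitSphere

theorem continuous_height : Continuous height := contMDiff_height.continuous

theorem continuous_diskPoint : Continuous diskPoint := contMDiff_diskPoint.continuous

/-- The harmonic function `r ^ |k| e ^ (i k φ)` on the plane. -/
noncomputable def harmonicMonomial (k : ℤ) (z : ℂ) : ℂ :=
  if 0 ≤ k then z ^ k.natAbs else (starRingEnd ℂ z) ^ k.natAbs

theorem contDiff_harmonicMonomial (k : ℤ) : ContDiff ℝ ∞ (harmonicMonomial k) := by
  unfold harmonicMonomial
  split_ifs
  · exact contDiff_id.pow _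
  · exact (Complex.conjCLE.contDiff).pow _

theorem harmonicMonomial_eq (k : ℤ) (z : ℂ) :
    harmonicMonomial k z = Complex.exp (Complex.I * k * z.arg) * (‖z‖ : ℂ) ^ k.natAbs := by
  have hz := Complex.norm_mul_exp_arg_mul_I z
  unfold harmonicMonomial
  split_ifs with h
  · conv_lhs => rw [← hz]
    have hk : (k : ℂ) = (k.natAbs : ℂ) := by
      rw [← Int.cast_natCast, Int.natAbs_of_nonneg h]
    rw [mul_pow, ← Complex.exp_nat_mul, mul_comm, hk]
    congr 2
    ring
  · conv_lhs => rw [← hz]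
    have hk : (k : ℂ) = -(k.natAbs : ℂ) := by
      rw [← Int.cast_natCast, Int.ofNat_natAbs_of_nonpos (by omega)]
      simp
    rw [map_mul, Complex.conj_ofReal, ← Complex.exp_conj, mul_pow, ← Complex.exp_nat_mul, mul_comm,
      hk]
    congr 2
    simp
    ring

theorem grushinEigenfunction_eq (n : ℕ) (k : ℤ) (q : UnitSphere) :
    grushinEigenfunction n k q = Complex.exp (Complex.I * k * (π / 2)) *
      harmonicMonomial k (diskPoint q) *
        ((hypergeometricPolynomial n k.natAbs).eval (1 - height q ^ 2) : ℝ) := by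
  have hcos : cos (sphericalCoord q).1 = ‖diskPoint q‖ := by
    rw [sphericalCoord, cos_arcsin]
    change √(1 - height q ^ 2) = _
    rw [← normSq_diskPoint, sqrt_sq (norm_nonneg _)]
  have hk : |(k : ℝ)| = (k.natAbs : ℝ) := by
    rw [Nat.cast_natAbs, Int.cast_abs]
  rw [grushinEigenfunction, hcos, harmonicMonomial_eq, hk, ← normSq_diskPoint,
    eval_hypergeometricPolynomial, mul_add, Complex.exp_add]
  have : (sphericalCoord q).2 = (diskPoint q).arg := rfl
  rw [this]
  push_cast
  ring

theorem contMDiff_grushinEigenfunction (n : ℕ) (k : ℤ) :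
    ContMDiff (𝓡 2) 𝓘(ℝ, ℂ) ∞ (grushinEigenfunction n k) := by
  have e : grushinEigenfunction n k = fun q => (fun w : ℂ × ℝ =>
      Complex.exp (Complex.I * k * (π / 2)) * harmonicMonomial k w.1 *
        ((hypergeometricPolynomial n k.natAbs).eval (1 - w.2 ^ 2) : ℝ)) (diskPoint q, height q) :=
    funext fun q => grushinEigenfunction_eq n k q
  rw [e]
  have h1 : ContDiff ℝ ∞ fun w : ℂ × ℝ =>
      (hypergeometricPolynomial n k.natAbs).eval (1 - w.2 ^ 2) :=
    (contDiff_polynomial_eval (hypergeometricPolynomial n k.natAbs)).comp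
      (contDiff_const.sub (contDiff_snd.pow 2))
  have h2 : ContDiff ℝ ∞ (fun w : ℂ × ℝ =>
      Complex.exp (Complex.I * k * (π / 2)) * harmonicMonomial k w.1 *
        ((hypergeometricPolynomial n k.natAbs).eval (1 - w.2 ^ 2) : ℝ)) :=
    (contDiff_const.mul ((contDiff_harmonicMonomial k).comp contDiff_fst)).mul
      (Complex.ofRealCLM.contDiff.comp h1)
  exact h2.contMDiff.comp (contMDiff_diskPoint.prodMk_space contMDiff_height)

/-- The radial factor `cos(x)^K F(-n, n + K; 1 + K; cos(x)^2)` of an eigenfunction. -/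
noncomputable def radialPart (n K : ℕ) (x : ℝ) : ℝ :=
  cos x ^ K * (hypergeometricPolynomial n K).eval (cos x ^ 2)

theorem grushinEigenfunction_sphericalPoint (n : ℕ) (k : ℤ) {p : ℝ × ℝ}
    (hp : p ∈ coordRectangle) :
    grushinEigenfunction n k (sphericalPoint p) =
      Complex.exp (Complex.I * k * (p.2 + π / 2)) * (radialPart n k.natAbs p.1 : ℂ) := by
  have hk : |(k : ℝ)| = (k.natAbs : ℝ) := by
    rw [Nat.cast_natAbs, Int.cast_abs]
  rw [grushinEigenfunction, sphericalCoord_sphericalPoint hp, radialPart, hk,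
    eval_hypergeometricPolynomial]

end Disk

/-! ### Integration with respect to the Grushin volume -/

section Volume

theorem measurable_tan : Measurable tan := by
  have : tan = fun x => sin x / cos x := funext tan_eq_sin_div_cos
  rw [this]
  exact measurable_sin.div measurable_cos

theorem measurable_sphericalPoint : Measurable sphericalPoint :=
  contMDiff_sphericalPoint.continuous.measurable

theorem measurable_sphericalCoord : Measurable sphericalCoord :=
  (continuous_arcsin.comp continuous_height).measurable.prodMk
    (Complex.measurable_arg.comp continuous_diskPoint.measurable)

theorem measurableSet_coordRectangle : MeasurableSet coordRectangle :=
  measurableSet_Ioo.prod measurableSet_Ioo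

theorem volume_coordRectangle_lt_top : volume coordRectangle < ⊤ := by
  rw [coordRectangle, Measure.volume_eq_prod, Measure.prod_prod]
  simp [ENNReal.mul_lt_top]

theorem integrable_grushinVolume_iff {g : UnitSphere → ℂ}
    (hg : AEStronglyMeasurable g grushinVolume) :
    Integrable g grushinVolume ↔
      IntegrableOn (fun p => (1 / |tan p.1|) • g (sphericalPoint p)) coordRectangle := by
  have hm : Measurable fun p : ℝ × ℝ => 1 / |tan p.1| := by
    have := measurable_tan
    fun_prop
  rw [grushinVolume] at hg ⊢
  rw [integrable_map_measure hg measurable_sphericalPoint.aemeasurable,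
    integrable_withDensity_iff_integrable_smul' hm.ennreal_ofReal (by simp), IntegrableOn]
  refine integrable_congr (Eventually.of_forall fun p => ?_)
  simp only [Function.comp_apply]
  rw [ENNReal.toReal_ofReal (by positivity)]

theorem integral_grushinVolume {g : UnitSphere → ℂ}
    (hg : AEStronglyMeasurable g grushinVolume) :
    ∫ q, g q ∂grushinVolume = ∫ p in coordRectangle, (1 / |tan p.1|) • g (sphericalPoint p) := by
  have hm : Measurable fun p : ℝ × ℝ => 1 / |tan p.1| := by
    have := measurable_tan
    fun_prop
  rw [grushinVolume] at hg ⊢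
  rw [integral_map measurable_sphericalPoint.aemeasurable hg,
    integral_withDensity_eq_integral_toReal_smul hm.ennreal_ofReal (by simp)]
  refine integral_congr_ae (Eventually.of_forall fun p => ?_)
  simp only
  rw [ENNReal.toReal_ofReal (by positivity)]

theorem ae_height_pos : ∀ᵐ q ∂grushinVolume, 0 < height q := by
  refine ae_grushinVolume_of_ae_coord (measurableSet_lt measurable_const continuous_height.measurable) ?_
  filter_upwards [ae_restrict_mem measurableSet_coordRectangle] with p hp
  rw [height_sphericalPoint]
  exact sin_pos_of_pos_of_lt_pi hp.1.1 (by linarith [hp.1.2, pi_pos])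

theorem memLp_height : MemLp (fun q => (height q : ℂ)) 2 grushinVolume := by
  have hc : Continuous fun q => (height q : ℂ) := Complex.continuous_ofReal.comp continuous_height
  have h : Integrable (fun q => ((height q ^ 2 : ℝ) : ℂ)) grushinVolume := by
    have hc2 : Continuous fun q => ((height q ^ 2 : ℝ) : ℂ) :=
      Complex.continuous_ofReal.comp (continuous_height.pow 2)
    rw [integrable_grushinVolume_iff hc2.aestronglyMeasurable]
    refine Measure.integrableOn_of_bounded (M := 1) volume_coordRectangle_lt_top.ne ?_ ?_
    · have := measurable_tan
      have h2 := continuous_height.measurable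
      have h3 := measurable_sphericalPoint
      exact Measurable.aestronglyMeasurable (by fun_prop)
    · filter_upwards [ae_restrict_mem measurableSet_coordRectangle] with p hp
      have hs : 0 < sin p.1 := sin_pos_of_pos_of_lt_pi hp.1.1 (by linarith [hp.1.2, pi_pos])
      have hcos : 0 < cos p.1 := cos_pos_of_mem_Ioo ⟨by linarith [hp.1.1, pi_pos], hp.1.2⟩
      rw [height_sphericalPoint, norm_smul, Complex.norm_real, tan_eq_sin_div_cos,
        abs_of_pos (by positivity), Real.norm_of_nonneg (by positivity),
        Real.norm_of_nonneg (by positivity)]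
      have : 1 / (sin p.1 / cos p.1) * sin p.1 ^ 2 = sin p.1 * cos p.1 := by field_simp
      rw [this]
      nlinarith [sin_le_one p.1, cos_le_one p.1]
  rw [memLp_two_iff_integrable_sq_norm hc.aestronglyMeasurable]
  refine h.norm.congr (Eventually.of_forall fun q => ?_)
  simp

/-- Functions that are dominated by the height are square integrable. -/
theorem memLp_of_norm_le_height {g : UnitSphere → ℂ}
    (hg : AEStronglyMeasurable g grushinVolume) {C : ℝ}
    (h : ∀ᵐ q ∂grushinVolume, ‖g q‖ ≤ C * height q) : MemLp g 2 grushinVolume := by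
  refine memLp_height.of_le_mul (c := C) hg ?_
  filter_upwards [h, ae_height_pos] with q hq hq'
  rwa [Complex.norm_real, Real.norm_of_nonneg hq'.le]

/-- The volume of the part of the hemisphere above a latitude circle diverges only
logarithmically. -/
theorem grushinVolume_le {a : ℝ} (ha : 0 < a) (ha1 : a ≤ 1) :
    grushinVolume {q | a ≤ height q} ≤ ENNReal.ofReal (2 * π * (-log a)) := by
  have hS : MeasurableSet {q | a ≤ height q} :=
    measurableSet_le measurable_const continuous_height.measurable
  have hx0 : 0 < arcsin a := arcsin_pos.2 ha
  have hx1 : arcsin a ≤ π / 2 := arcsin_le_pi_div_two a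
  set R : Set (ℝ × ℝ) := Icc (arcsin a) (π / 2) ×ˢ Icc (-π) π with hR
  have hRm : MeasurableSet R := measurableSet_Icc.prod measurableSet_Icc
  have hsin : ∀ x ∈ Icc (arcsin a) (π / 2), 0 < sin x := fun x hx =>
    sin_pos_of_pos_of_lt_pi (hx0.trans_le hx.1) (by linarith [hx.2, pi_pos])
  have hcot : ContinuousOn (fun x => cos x / sin x) (Icc (arcsin a) (π / 2)) :=
    continuous_cos.continuousOn.div continuous_sin.continuousOn fun x hx => (hsin x hx).ne'
  have hint : ∫ x in Icc (arcsin a) (π / 2), cos x / sin x = -log a := by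
    rw [integral_Icc_eq_integral_Ioc, ← intervalIntegral.integral_of_le hx1,
      intervalIntegral.integral_eq_sub_of_hasDerivAt (f := fun x => log (sin x))]
    · rw [sin_arcsin (by linarith) ha1]
      simp
    · intro x hx
      rw [uIcc_of_le hx1] at hx
      exact (hasDerivAt_sin x).log (hsin x hx).ne'
    · apply ContinuousOn.intervalIntegrable
      rwa [uIcc_of_le hx1]
  have hI : IntegrableOn (fun p : ℝ × ℝ => cos p.1 / sin p.1) R := by
    refine ContinuousOn.integrableOn_compact (isCompact_Icc.prod isCompact_Icc) ?_
    exact hcot.comp continuousOn_fst fun p hp => hp.1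
  have hval : ∫ p in R, cos p.1 / sin p.1 = 2 * π * (-log a) := by
    have := setIntegral_prod_mul (μ := volume) (ν := volume) (fun x : ℝ => cos x / sin x)
      (fun _ : ℝ => (1 : ℝ)) (Icc (arcsin a) (π / 2)) (Icc (-π) π)
    rw [← Measure.volume_eq_prod] at this
    simp only [mul_one] at this
    rw [this, hint]
    simp
    rw [max_eq_left (by linarith [pi_pos])]
    ring
  rw [← hval, ofReal_integral_eq_lintegral_ofReal hI, grushinVolume,
    Measure.map_apply measurable_sphericalPoint hS,
    withDensity_apply _ (measurable_sphericalPoint hS), Measure.restrict_restrict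
      (measurable_sphericalPoint hS)]
  · have hsub : sphericalPoint ⁻¹' {q | a ≤ height q} ∩ coordRectangle ⊆ R := by
      rintro p ⟨hp1, hp2⟩
      simp only [mem_preimage, mem_ofPred_eq, height_sphericalPoint] at hp1
      refine ⟨⟨?_, hp2.1.2.le⟩, hp2.2.1.le, hp2.2.2.le⟩
      rw [arcsin_le_iff_le_sin' ⟨by linarith [hp2.1.1, pi_pos], hp2.1.2⟩]
      exact hp1
    refine (lintegral_mono_set hsub).trans (le_of_eq ?_)
    refine setLIntegral_congr_fun hRm fun p hp => ?_
    have h1 := hsin _ hp.1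
    have h2 : 0 ≤ cos p.1 := cos_nonneg_of_mem_Icc ⟨by linarith [hp.1.1, pi_pos], hp.1.2⟩
    rw [tan_eq_sin_div_cos, abs_of_nonneg (by positivity), one_div_div]
  · filter_upwards [ae_restrict_mem hRm] with p hp
    have h1 := hsin _ hp.1
    have h2 : 0 ≤ cos p.1 := cos_nonneg_of_mem_Icc ⟨by linarith [hp.1.1, pi_pos], hp.1.2⟩
    simp only [Pi.zero_apply]
    positivity

end Volume

/-! ### The eigenfunctions as elements of the Hilbert space -/

section Eigenfunctions

theorem exists_norm_le_of_continuous {g : UnitSphere → ℂ} (hg : Continuous g) :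
    ∃ C, 0 ≤ C ∧ ∀ q, ‖g q‖ ≤ C := by
  obtain ⟨C, hC⟩ := isCompact_univ.exists_bound_of_continuousOn hg.continuousOn
  exact ⟨|C|, abs_nonneg C, fun q => (hC q (mem_univ q)).trans (le_abs_self C)⟩

/-- The eigenfunctions vanish to second order at the equator, as functions of the height. -/
theorem exists_grushinEigenfunction_le {n : ℕ} (hn : 1 ≤ n) (k : ℤ) :
    ∃ C, 0 ≤ C ∧ ∀ q, ‖grushinEigenfunction n k q‖ ≤ C * height q ^ 2 := by
  obtain ⟨C, hC0, hC⟩ := exists_norm_le_of_continuous (g := fun q =>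
    Complex.exp (Complex.I * k * (π / 2)) * harmonicMonomial k (diskPoint q) *
      ((reducedPolynomial n k.natAbs).eval (1 - height q ^ 2) : ℝ)) <| by
    have h1 := continuous_height
    have h2 := (contDiff_harmonicMonomial k).continuous.comp continuous_diskPoint
    have h3 : Continuous fun q => (reducedPolynomial n k.natAbs).eval (1 - height q ^ 2) :=
      (reducedPolynomial n k.natAbs).continuous.comp (by fun_prop)
    exact (continuous_const.mul h2).mul (Complex.continuous_ofReal.comp h3)
  refine ⟨C, hC0, fun q => ?_⟩
  rw [grushinEigenfunction_eq, hypergeometricPolynomial_eq hn]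
  have := mul_le_mul_of_nonneg_right (hC q) (sq_nonneg (height q))
  refine le_trans (le_of_eq ?_) this
  rw [← Real.norm_of_nonneg (sq_nonneg (height q)), ← Complex.norm_real, ← norm_mul]
  congr 1
  simp
  ring

theorem memLp_grushinEigenfunction {n : ℕ} (hn : 1 ≤ n) (k : ℤ) :
    MemLp (grushinEigenfunction n k) 2 grushinVolume := by
  obtain ⟨C, hC0, hC⟩ := exists_grushinEigenfunction_le hn k
  refine memLp_of_norm_le_height (C := C)
    (contMDiff_grushinEigenfunction n k).continuous.aestronglyMeasurable ?_
  filter_upwards [ae_height_pos] with q hq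
  refine (hC q).trans (mul_le_mul_of_nonneg_left ?_ hC0)
  nlinarith [height_sq_le q]

/-- The class of `ψ_{n,k}` in `L²(S₊, dω)`. -/
noncomputable def eigenvector {n : ℕ} (hn : 1 ≤ n) (k : ℤ) : GrushinL2 :=
  (memLp_grushinEigenfunction hn k).toLp _

theorem coeFn_eigenvector {n : ℕ} (hn : 1 ≤ n) (k : ℤ) :
    eigenvector hn k =ᵐ[grushinVolume] grushinEigenfunction n k :=
  (memLp_grushinEigenfunction hn k).coeFn_toLp

theorem eigenvector_ne_zero {n : ℕ} (hn : 1 ≤ n) (k : ℤ) : eigenvector hn k ≠ 0 := by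
  intro h0
  have h1 : ∀ᵐ q ∂grushinVolume, grushinEigenfunction n k q = 0 := by
    filter_upwards [coeFn_eigenvector hn k, Lp.coeFn_zero ℂ 2 grushinVolume] with q ha hb
    rw [← ha, h0, hb, Pi.zero_apply]
  have hopen : IsOpen coordRectangle := isOpen_Ioo.prod isOpen_Ioo
  have h2 : EqOn (fun p => grushinEigenfunction n k (sphericalPoint p)) (fun _ => 0)
      coordRectangle :=
    Measure.eqOn_open_of_ae_eq (ae_coord_of_ae_grushinVolume h1) hopen
      ((contMDiff_grushinEigenfunction n k).continuous.comp
        contMDiff_sphericalPoint.continuous).continuousOn continuousOn_const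
  have h3 : hypergeometricPolynomial n k.natAbs = 0 := by
    refine Polynomial.eq_zero_of_infinite_isRoot _ ((Ioo_infinite (zero_lt_one' ℝ)).mono ?_)
    intro t ht
    have hs : 0 < √t := sqrt_pos.2 ht.1
    have hs1 : √t < 1 := by rw [sqrt_lt' one_pos]; simpa using ht.2
    have hmem : (arccos √t, (0 : ℝ)) ∈ coordRectangle :=
      ⟨⟨arccos_pos.2 hs1, arccos_lt_pi_div_two.2 hs⟩, by simpa using pi_pos, pi_pos⟩
    have h4 := h2 hmem
    simp only at h4
    rw [grushinEigenfunction_sphericalPoint n k hmem, radialPart,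
      cos_arccos (by linarith) hs1.le, sq_sqrt ht.1.le] at h4
    have h5 := (mul_eq_zero.1 h4).resolve_left (Complex.exp_ne_zero _)
    have h6 := Complex.ofReal_eq_zero.1 h5
    exact (mul_eq_zero.1 h6).resolve_left (pow_ne_zero _ hs.ne')
  have h4 := degree_hypergeometricPolynomial hn k.natAbs
  rw [h3, Polynomial.degree_zero] at h4
  exact WithBot.bot_ne_coe h4

end Eigenfunctions

/-! ### Partial derivatives in the coordinates -/

section PartialDerivatives

/-- The partial derivative `∂ₓ u`. -/
noncomputable def partialX (u : ℝ × ℝ → ℂ) (p : ℝ × ℝ) : ℂ := deriv (fun x => u (x, p.2)) p.1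

/-- The partial derivative `∂_φ u`. -/
noncomputable def partialPhi (u : ℝ × ℝ → ℂ) (p : ℝ × ℝ) : ℂ := deriv (fun φ => u (p.1, φ)) p.2

variable {u : ℝ × ℝ → ℂ}

theorem contDiff_partialX (hu : ContDiff ℝ ∞ u) : ContDiff ℝ ∞ (partialX u) := by
  have e : partialX u = fun p => fderiv ℝ u p (1, 0) := by
    funext p
    have h1 : HasFDerivAt u (fderiv ℝ u p) (p.1, p.2) := (hu.differentiable (by simp) p).hasFDerivAt
    have h2 : HasDerivAt (fun x : ℝ => (x, p.2)) ((1 : ℝ), (0 : ℝ)) p.1 :=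
      (hasDerivAt_id p.1).prodMk (hasDerivAt_const p.1 p.2)
    exact (h1.comp_hasDerivAt p.1 h2).deriv
  rw [e]
  exact (hu.fderiv_right (by simp)).clm_apply contDiff_const

theorem contDiff_partialPhi (hu : ContDiff ℝ ∞ u) : ContDiff ℝ ∞ (partialPhi u) := by
  have e : partialPhi u = fun p => fderiv ℝ u p (0, 1) := by
    funext p
    have h1 : HasFDerivAt u (fderiv ℝ u p) (p.1, p.2) := (hu.differentiable (by simp) p).hasFDerivAt
    have h2 : HasDerivAt (fun φ : ℝ => (p.1, φ)) ((0 : ℝ), (1 : ℝ)) p.2 :=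
      (hasDerivAt_const p.2 p.1).prodMk (hasDerivAt_id p.2)
    exact (h1.comp_hasDerivAt p.2 h2).deriv
  rw [e]
  exact (hu.fderiv_right (by simp)).clm_apply contDiff_const

theorem coordLaplacian_eq (u : ℝ × ℝ → ℂ) (p : ℝ × ℝ) :
    coordLaplacian u p = partialX (partialX u) p
      - ((1 / (sin p.1 * cos p.1) : ℝ) : ℂ) * partialX u p
      + ((tan p.1 ^ 2 : ℝ) : ℂ) * partialPhi (partialPhi u) p := by
  rw [coordLaplacian, iteratedDeriv_succ, iteratedDeriv_one, iteratedDeriv_succ, iteratedDeriv_one]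
  rfl

theorem measurable_coordLaplacian (hu : ContDiff ℝ ∞ u) : Measurable (coordLaplacian u) := by
  have e : coordLaplacian u = fun p => _ := funext fun p => coordLaplacian_eq u p
  rw [e]
  have h1 := (contDiff_partialX hu).continuous.measurable
  have h2 := (contDiff_partialX (contDiff_partialX hu)).continuous.measurable
  have h3 := (contDiff_partialPhi (contDiff_partialPhi hu)).continuous.measurable
  have h4 := measurable_tan
  have h5 : Measurable fun p : ℝ × ℝ => ((1 / (sin p.1 * cos p.1) : ℝ) : ℂ) :=
    Complex.measurable_ofReal.comp (by fun_prop)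
  have h6 : Measurable fun p : ℝ × ℝ => ((tan p.1 ^ 2 : ℝ) : ℂ) :=
    Complex.measurable_ofReal.comp (by fun_prop)
  exact (h2.sub (h5.mul h1)).add (h6.mul h3)

theorem IsHemisphereTestFunction.measurable_grushinLaplacianFun {f : UnitSphere → ℂ}
    (hf : IsHemisphereTestFunction f) : Measurable (grushinLaplacianFun f) :=
  (measurable_coordLaplacian hf.contDiff).comp measurable_sphericalCoord

end PartialDerivatives

/-! ### The radial equation -/

section Radial

theorem contDiff_radialPart (n K : ℕ) : ContDiff ℝ ∞ (radialPart n K) :=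
  (contDiff_cos.pow K).mul ((contDiff_polynomial_eval _).comp (contDiff_cos.pow 2))

theorem hasDerivAt_cos_pow (K : ℕ) {x : ℝ} (hx : cos x ≠ 0) :
    HasDerivAt (fun x => cos x ^ K) (-(K * tan x * cos x ^ K)) x := by
  refine ((hasDerivAt_cos x).pow K).congr_deriv ?_
  rcases K with _ | K
  · simp
  · rw [tan_eq_sin_div_cos, pow_succ, Nat.add_sub_cancel]
    field_simp

theorem hasDerivAt_eval_cos_sq (p : Polynomial ℝ) (x : ℝ) :
    HasDerivAt (fun x => p.eval (cos x ^ 2))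
      (-(2 * sin x * cos x * p.derivative.eval (cos x ^ 2))) x := by
  have h := (p.hasDerivAt (cos x ^ 2)).comp x ((hasDerivAt_cos x).pow 2)
  refine h.congr_deriv ?_
  simp
  ring

theorem hasDerivAt_radialPart (n K : ℕ) {x : ℝ} (hx : cos x ≠ 0) :
    HasDerivAt (radialPart n K) (-(cos x ^ K * (K * tan x * (hypergeometricPolynomial n K).eval
      (cos x ^ 2) + 2 * sin x * cos x *
        (hypergeometricPolynomial n K).derivative.eval (cos x ^ 2)))) x := by
  refine ((hasDerivAt_cos_pow K hx).mul (hasDerivAt_eval_cos_sq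
    (hypergeometricPolynomial n K) x)).congr_deriv ?_
  ring

/-- The radial part satisfies `R'' - R' / (sin x cos x) - K² tan² x R = -4 n (n + K) R`, which is the
hypergeometric equation in the variable `cos² x`. -/
theorem radialPart_ode (n K : ℕ) {x : ℝ} (hx : x ∈ Ioo 0 (π / 2)) :
    deriv (deriv (radialPart n K)) x - 1 / (sin x * cos x) * deriv (radialPart n K) x
      - K ^ 2 * tan x ^ 2 * radialPart n K x = -(4 * n * (n + K)) * radialPart n K x := by
  have hc : cos x ≠ 0 := (cos_pos_of_mem_Ioo ⟨by linarith [hx.1, pi_pos], hx.2⟩).ne'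
  have hs : sin x ≠ 0 := (sin_pos_of_pos_of_lt_pi hx.1 (by linarith [hx.2, pi_pos])).ne'
  set P := hypergeometricPolynomial n K with hP
  have h1 : deriv (radialPart n K) =ᶠ[𝓝 x] fun x => -(cos x ^ K * (K * tan x * P.eval
      (cos x ^ 2) + 2 * sin x * cos x * P.derivative.eval (cos x ^ 2))) := by
    filter_upwards [continuous_cos.continuousAt.eventually_ne hc] with y hy
    exact (hasDerivAt_radialPart n K hy).deriv
  have h2 : HasDerivAt (fun x => -(cos x ^ K * (K * tan x * P.eval
      (cos x ^ 2) + 2 * sin x * cos x * P.derivative.eval (cos x ^ 2)))) _ x :=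
    ((hasDerivAt_cos_pow K hc).mul ((((hasDerivAt_tan hc).const_mul (K : ℝ)).mul
      (hasDerivAt_eval_cos_sq P x)).add ((((hasDerivAt_sin x).const_mul 2).mul
        (hasDerivAt_cos x)).mul (hasDerivAt_eval_cos_sq P.derivative x)))).neg
  rw [h1.deriv_eq, h2.deriv, h1.self_of_nhds, radialPart, ← hP]
  simp only [Pi.mul_apply, Pi.add_apply, tan_eq_sin_div_cos]
  -- With `t = cos² x`, the claim is `4 cos^K x` times the hypergeometric equation at `t`.
  have hode := hypergeometricPolynomial_ode n K (cos x ^ 2)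
  rw [← hP] at hode
  set a := P.eval (cos x ^ 2)
  set a' := P.derivative.eval (cos x ^ 2)
  set a'' := P.derivative.derivative.eval (cos x ^ 2)
  have hsq : sin x ^ 2 = 1 - cos x ^ 2 := by linarith [sin_sq_add_cos_sq x]
  set s := sin x
  set c := cos x
  set C := c ^ K
  have e : 1 - c ^ 2 = s ^ 2 := hsq.symm
  rw [e] at hode
  field_simp
  linear_combination c ^ 2 * (4 * C * hode - 2 * C * a' * hsq)

/-- Green's identity on the radial interval, for `F` vanishing near the equator `x = 0`: the boundary
terms `cot x (R F' - R' F)` vanish at the equator since `F` does and at the pole since `cot x` does.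
The factor `1 / sin x` is written as `1 / max (sin x) δ`, which is the same on the support of `F` and
is continuous. -/
theorem integral_radialPart_mul_eq_zero (n K : ℕ) {F : ℝ → ℂ} (hF : ContDiff ℝ ∞ F) {δ : ℝ}
    (hδ : 0 < δ) (hF0 : ∀ x, sin x < δ → F x = 0) :
    ∫ x in Ioo 0 (π / 2), ((radialPart n K x : ℂ) *
      ((cos x * (max (sin x) δ)⁻¹ : ℝ) * deriv (deriv F) x
        - (((max (sin x) δ)⁻¹ ^ 2 : ℝ) : ℂ) * deriv F x)
      - ((K ^ 2 * sin x * cos x ^ (K - 1) * (hypergeometricPolynomial n K).eval (cos x ^ 2) : ℝ) : ℂ)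
        * F x
      + ((4 * n * (n + K) : ℝ) : ℂ) * (radialPart n K x : ℂ) * ((cos x * (max (sin x) δ)⁻¹ : ℝ) : ℂ)
        * F x) = 0 := by
  have hF1 : ContDiff ℝ ∞ (deriv F) := (contDiff_infty_iff_deriv.1 hF).2
  have hF2 : ContDiff ℝ ∞ (deriv (deriv F)) := (contDiff_infty_iff_deriv.1 hF1).2
  have hR := contDiff_radialPart n K
  have hR1 : ContDiff ℝ ∞ (deriv (radialPart n K)) := (contDiff_infty_iff_deriv.1 hR).2
  have hopen : IsOpen {x | sin x < δ} := isOpen_lt continuous_sin continuous_const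
  have hz1 : ∀ x, sin x < δ → deriv F x = 0 := fun x hx => by
    have : F =ᶠ[𝓝 x] fun _ => 0 := by
      filter_upwards [hopen.mem_nhds hx] with y hy using hF0 y hy
    rw [this.deriv_eq, deriv_const]
  have hz2 : ∀ x, sin x < δ → deriv (deriv F) x = 0 := fun x hx => by
    have : deriv F =ᶠ[𝓝 x] fun _ => 0 := by
      filter_upwards [hopen.mem_nhds hx] with y hy using hz1 y hy
    rw [this.deriv_eq, deriv_const]
  have hκ : Continuous fun x => (max (sin x) δ)⁻¹ :=
    (continuous_sin.max continuous_const).inv₀ fun x => (lt_max_of_lt_right hδ).ne'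
  -- `W = cot x (R F' - R' F)` is a primitive of the integrand.
  set W : ℝ → ℂ := fun x => ((cos x * (max (sin x) δ)⁻¹ : ℝ) : ℂ) *
    ((radialPart n K x : ℂ) * deriv F x - ((deriv (radialPart n K) x : ℝ) : ℂ) * F x) with hW
  have hcW : Continuous W := by
    have h0 := hF.continuous
    have h1 := hF1.continuous
    have h2 := hR.continuous
    have h3 := hR1.continuous
    have h4 := Complex.continuous_ofReal
    have h5 : Continuous fun x => ((cos x * (max (sin x) δ)⁻¹ : ℝ) : ℂ) :=
      h4.comp (continuous_cos.mul hκ)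
    exact h5.mul (((h4.comp h2).mul h1).sub ((h4.comp h3).mul h0))
  have hcP : Continuous fun x =>
      ((K ^ 2 * sin x * cos x ^ (K - 1) *
        (hypergeometricPolynomial n K).eval (cos x ^ 2) : ℝ) : ℂ) := by
    have h1 : Continuous fun x => (hypergeometricPolynomial n K).eval (cos x ^ 2) :=
      (hypergeometricPolynomial n K).continuous.comp (continuous_cos.pow 2)
    have h2 := continuous_cos
    have h3 := continuous_sin
    exact Complex.continuous_ofReal.comp (by fun_prop)
  rw [← integral_Ioc_eq_integral_Ioo, ← intervalIntegral.integral_of_le (by positivity),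
    intervalIntegral.integral_eq_sub_of_hasDerivAt_of_le (by positivity) hcW.continuousOn (f := W)]
  · have h0 : sin 0 < δ := by simpa using hδ
    simp [hW, hF0 0 h0, hz1 0 h0]
  · intro x hx
    have hs : 0 < sin x := sin_pos_of_pos_of_lt_pi hx.1 (by linarith [hx.2, pi_pos])
    have hc : 0 < cos x := cos_pos_of_mem_Ioo ⟨by linarith [hx.1, pi_pos], hx.2⟩
    have hWe : W =ᶠ[𝓝 x] fun x => ((cos x / sin x : ℝ) : ℂ) *
        ((radialPart n K x : ℂ) * deriv F x - ((deriv (radialPart n K) x : ℝ) : ℂ) * F x) := by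
      refine Eventually.of_forall fun y => ?_
      simp only [hW]
      rcases lt_or_ge (sin y) δ with h | h
      · rw [hF0 y h, hz1 y h]
        simp
      · rw [max_eq_left h, div_eq_mul_inv]
    refine HasDerivAt.congr_of_eventuallyEq ?_ hWe
    have d1 : HasDerivAt (fun x => ((cos x / sin x : ℝ) : ℂ)) _ x :=
      ((hasDerivAt_cos x).div (hasDerivAt_sin x) hs.ne').ofReal_comp
    have d2 : HasDerivAt F (deriv F x) x := (hF.differentiable (by simp) x).hasDerivAt
    have d3 : HasDerivAt (deriv F) (deriv (deriv F) x) x :=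
      (hF1.differentiable (by simp) x).hasDerivAt
    have d4 : HasDerivAt (fun x => (radialPart n K x : ℂ)) _ x :=
      (hR.differentiable (by simp) x).hasDerivAt.ofReal_comp
    have d5 : HasDerivAt (fun x => ((deriv (radialPart n K) x : ℝ) : ℂ)) _ x :=
      (hR1.differentiable (by simp) x).hasDerivAt.ofReal_comp
    have d := d1.mul ((d4.mul d3).sub (d5.mul d2))
    refine d.congr_deriv ?_
    rcases lt_or_ge (sin x) δ with h | h
    · rw [hF0 x h, hz1 x h, hz2 x h]
      simp [hF0 x h, hz1 x h]
    · rw [max_eq_left h]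
      have hode := radialPart_ode n K hx
      have hS : (K ^ 2 * sin x * cos x ^ (K - 1) *
          (hypergeometricPolynomial n K).eval (cos x ^ 2) : ℝ) =
            K ^ 2 * (sin x / cos x) * radialPart n K x := by
        rw [radialPart]
        -- For `K = 0` the truncated exponent `K - 1` is harmless because of the factor `K ^ 2`.
        rcases K with _ | K
        · simp
        · rw [Nat.add_sub_cancel, pow_succ]
          field_simp
          ring
      rw [hS]
      rw [tan_eq_sin_div_cos] at hode
      have hsq := sin_sq_add_cos_sq x
      have hode2 : ((deriv (deriv (radialPart n K)) x : ℝ) : ℂ) =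
        ((1 / (sin x * cos x) * deriv (radialPart n K) x
          + K ^ 2 * (sin x / cos x) ^ 2 * radialPart n K x
          -(4 * n * (n + K)) * radialPart n K x : ℝ) : ℂ) := by
        rw [← sub_eq_zero] at hode
        rw [← sub_eq_zero, ← Complex.ofReal_sub, ← Complex.ofReal_zero]
        congr 1
        linarith
      simp only [Pi.sub_apply, Pi.mul_apply, hode2]
      have hsq' : ((sin x : ℝ) : ℂ) ^ 2 + ((cos x : ℝ) : ℂ) ^ 2 = 1 := by exact_mod_cast hsq
      have hs' : ((sin x : ℝ) : ℂ) ≠ 0 := by exact_mod_cast hs.ne'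
      have hc' : ((cos x : ℝ) : ℂ) ≠ 0 := by exact_mod_cast hc.ne'
      push_cast [-Complex.ofReal_sin, -Complex.ofReal_cos] at hs' hc' hsq' ⊢
      field_simp
      linear_combination -((cos x : ℝ) : ℂ) * ((radialPart n K x : ℂ) * deriv F x -
        ((deriv (radialPart n K) x : ℝ) : ℂ) * F x) * hsq'
  · apply Continuous.intervalIntegrable
    have h0 := hF.continuous
    have h1 := hF1.continuous
    have h2 := hR.continuous
    have h3 := hF2.continuous
    have h4 := Complex.continuous_ofReal
    have h5 : Continuous fun x => ((cos x * (max (sin x) δ)⁻¹ : ℝ) : ℂ) :=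
      h4.comp (continuous_cos.mul hκ)
    have h6 : Continuous fun x => ((((max (sin x) δ)⁻¹ ^ 2 : ℝ)) : ℂ) := h4.comp (hκ.pow 2)
    have h7 : Continuous fun x => (radialPart n K x : ℂ) := h4.comp h2
    fun_prop

/-- Integration by parts over a full circle. -/
theorem integral_exp_mul_eq_zero (k : ℤ) {g : ℝ → ℂ} (hg : ContDiff ℝ ∞ g)
    (hper : Function.Periodic g (2 * π)) :
    ∫ φ in Ioo (-π) π, Complex.exp (-(Complex.I * k * φ)) *
      (deriv (deriv g) φ + (k : ℂ) ^ 2 * g φ) = 0 := by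
  have hg1 : ContDiff ℝ ∞ (deriv g) := (contDiff_infty_iff_deriv.1 hg).2
  have hg2 : ContDiff ℝ ∞ (deriv (deriv g)) := (contDiff_infty_iff_deriv.1 hg1).2
  have hper1 : Function.Periodic (deriv g) (2 * π) := by
    intro x
    rw [← deriv_comp_add_const]
    congr 1
    exact funext hper
  have hexp : Function.Periodic (fun φ : ℝ => Complex.exp (-(Complex.I * k * φ))) (2 * π) := by
    intro x
    have : -(Complex.I * k * ((x + 2 * π : ℝ) : ℂ)) =
        -(Complex.I * k * x) + ((-k : ℤ) : ℂ) * (2 * π * Complex.I) := by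
      push_cast
      ring
    simp only
    rw [this]
    exact Complex.exp_periodic.int_mul (-k) _
  -- `W = e^{-ikφ} (g' + i k g)` is a periodic primitive of the integrand.
  set W : ℝ → ℂ := fun φ => Complex.exp (-(Complex.I * k * φ)) *
    (deriv g φ + Complex.I * k * g φ) with hW
  have hperW : Function.Periodic W (2 * π) := by
    intro x
    simp only [hW]
    have := hexp x
    simp only at this
    rw [this, hper1, hper]
  rw [← integral_Ioc_eq_integral_Ioo, ← intervalIntegral.integral_of_le (by linarith [pi_pos]),
    intervalIntegral.integral_eq_sub_of_hasDerivAt (f := W)]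
  · have := hperW (-π)
    rw [show -π + 2 * π = π by ring] at this
    rw [this, sub_self]
  · intro x _
    have d0 : HasDerivAt (fun φ : ℝ => -(Complex.I * k * φ)) (-(Complex.I * k)) x := by
      exact ((hasDerivAt_id x).ofReal_comp.const_mul (Complex.I * (k : ℂ))).neg.congr_deriv (by simp)
    have d1 := d0.cexp
    have d2 : HasDerivAt g (deriv g x) x := (hg.differentiable (by simp) x).hasDerivAt
    have d3 : HasDerivAt (deriv g) (deriv (deriv g) x) x :=
      (hg1.differentiable (by simp) x).hasDerivAt
    refine (d1.mul (d3.add (d2.const_mul (Complex.I * (k : ℂ))))).congr_deriv ?_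
    simp only [Pi.add_apply]
    linear_combination -(Complex.exp (-(Complex.I * k * x)) * (k : ℂ) ^ 2 * g x) * Complex.I_sq
  · apply Continuous.intervalIntegrable
    have h0 := hg.continuous
    have h1 := hg2.continuous
    have h2 := Complex.continuous_ofReal
    fun_prop

end Radial

/-! ### Symmetry on test functions -/

section Symmetry

theorem IsHemisphereTestFunction.exists_eq_zero {f : UnitSphere → ℂ}
    (hf : IsHemisphereTestFunction f) : ∃ δ > 0, ∀ q, height q < δ → f q = 0 := by
  rcases (tsupport f).eq_empty_or_nonempty with h | h
  · rw [tsupport_eq_empty_iff] at h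
    exact ⟨1, one_pos, fun q _ => by rw [h, Pi.zero_apply]⟩
  · obtain ⟨q₀, hq₀, hmin⟩ := (isClosed_tsupport f).isCompact.exists_isMinOn h
      continuous_height.continuousOn
    refine ⟨height q₀, hf.2 hq₀, fun q hq => ?_⟩
    by_contra hne
    exact absurd (hmin (subset_tsupport f hne)) (not_le.2 hq)

theorem sphericalPoint_add_two_pi (x φ : ℝ) :
    sphericalPoint (x, φ + 2 * π) = sphericalPoint (x, φ) := by
  simp [sphericalPoint]

theorem grushinEigenvalue_eq (n : ℕ) (k : ℤ) :
    grushinEigenvalue n k = 4 * n * (n + (k.natAbs : ℝ)) := by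
  rw [grushinEigenvalue, Nat.cast_natAbs, Int.cast_abs]

/-- Green's identity for a test function `u` and an eigenfunction, in coordinates. The integrand is
split into a part with the `x`-derivatives and a part with the `φ`-derivatives. The former is bounded,
so that it is integrable; hence so is the latter. Either part then is integrated first in the variable
of its derivatives. -/
theorem integral_eigenfunction_mul_laplacian (n : ℕ) (k : ℤ) {u : ℝ × ℝ → ℂ}
    (hu : ContDiff ℝ ∞ u) (hper : ∀ x φ, u (x, φ + 2 * π) = u (x, φ)) {δ : ℝ} (hδ : 0 < δ)
    (hu0 : ∀ p : ℝ × ℝ, sin p.1 < δ → u p = 0)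
    (hint : IntegrableOn (fun p : ℝ × ℝ => Complex.exp (-(Complex.I * k * p.2)) *
      (((cos p.1 / sin p.1 : ℝ) : ℂ) * (radialPart n k.natAbs p.1 : ℂ) *
        (coordLaplacian u p + (grushinEigenvalue n k : ℂ) * u p))) coordRectangle) :
    ∫ p in coordRectangle, Complex.exp (-(Complex.I * k * p.2)) *
      (((cos p.1 / sin p.1 : ℝ) : ℂ) * (radialPart n k.natAbs p.1 : ℂ) *
        (coordLaplacian u p + (grushinEigenvalue n k : ℂ) * u p)) = 0 := by
  set K := k.natAbs with hK
  have hk2 : ((k : ℂ)) ^ 2 = (K : ℂ) ^ 2 := by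
    have := Int.natAbs_sq k
    rw [← hK] at this
    exact_mod_cast this.symm
  set G : ℝ × ℝ → ℂ := fun p => Complex.exp (-(Complex.I * k * p.2)) *
    ((radialPart n K p.1 : ℂ) *
      ((cos p.1 * (max (sin p.1) δ)⁻¹ : ℝ) * partialX (partialX u) p
        - (((max (sin p.1) δ)⁻¹ ^ 2 : ℝ) : ℂ) * partialX u p)
      - ((K ^ 2 * sin p.1 * cos p.1 ^ (K - 1) *
          (hypergeometricPolynomial n K).eval (cos p.1 ^ 2) : ℝ) : ℂ) * u p
      + ((4 * n * (n + K) : ℝ) : ℂ) * (radialPart n K p.1 : ℂ) *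
        ((cos p.1 * (max (sin p.1) δ)⁻¹ : ℝ) : ℂ) * u p) with hG
  -- The factor `tan x` in `J` is unbounded at the pole when `k = 0`; integrability of `J` comes from
  -- that of `G + J`.
  set J : ℝ × ℝ → ℂ := fun p => ((sin p.1 / cos p.1 : ℝ) : ℂ) * (radialPart n K p.1 : ℂ) *
    (Complex.exp (-(Complex.I * k * p.2)) *
      (partialPhi (partialPhi u) p + (k : ℂ) ^ 2 * u p)) with hJ
  have hGc : Continuous G := by
    have h0 := hu.continuous
    have h1 := (contDiff_partialX hu).continuous
    have h2 := (contDiff_partialX (contDiff_partialX hu)).continuous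
    have h4 := Complex.continuous_ofReal
    have hκ : Continuous fun p : ℝ × ℝ => (max (sin p.1) δ)⁻¹ :=
      ((continuous_sin.comp continuous_fst).max continuous_const).inv₀
        fun x => (lt_max_of_lt_right hδ).ne'
    have h5 : Continuous fun p : ℝ × ℝ => ((cos p.1 * (max (sin p.1) δ)⁻¹ : ℝ) : ℂ) :=
      h4.comp ((continuous_cos.comp continuous_fst).mul hκ)
    have h6 : Continuous fun p : ℝ × ℝ => ((((max (sin p.1) δ)⁻¹ ^ 2 : ℝ)) : ℂ) :=
      h4.comp (hκ.pow 2)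
    have h7 : Continuous fun p : ℝ × ℝ => (radialPart n K p.1 : ℂ) :=
      h4.comp ((contDiff_radialPart n K).continuous.comp continuous_fst)
    have h8 : Continuous fun p : ℝ × ℝ => ((K ^ 2 * sin p.1 * cos p.1 ^ (K - 1) *
          (hypergeometricPolynomial n K).eval (cos p.1 ^ 2) : ℝ) : ℂ) := by
      have h1 : Continuous fun p : ℝ × ℝ => (hypergeometricPolynomial n K).eval (cos p.1 ^ 2) :=
        (hypergeometricPolynomial n K).continuous.comp
          ((continuous_cos.comp continuous_fst).pow 2)
      have h2 := continuous_cos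
      have h3 := continuous_sin
      exact h4.comp (by fun_prop)
    fun_prop
  have hGi : IntegrableOn G coordRectangle :=
    (hGc.continuousOn.integrableOn_compact
      ((isCompact_Icc (a := (0 : ℝ)) (b := π / 2)).prod (isCompact_Icc (a := -π) (b := π)))).mono_set
      (prod_mono Ioo_subset_Icc_self Ioo_subset_Icc_self)
  have hopen : IsOpen {x | sin x < δ} := isOpen_lt continuous_sin continuous_const
  have hsplit : ∀ p ∈ coordRectangle, Complex.exp (-(Complex.I * k * p.2)) *
      (((cos p.1 / sin p.1 : ℝ) : ℂ) * (radialPart n K p.1 : ℂ) *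
        (coordLaplacian u p + (grushinEigenvalue n k : ℂ) * u p)) = G p + J p := by
    intro p hp
    have hs : 0 < sin p.1 := sin_pos_of_pos_of_lt_pi hp.1.1 (by linarith [hp.1.2, pi_pos])
    have hc : 0 < cos p.1 := cos_pos_of_mem_Ioo ⟨by linarith [hp.1.1, pi_pos], hp.1.2⟩
    have hS : (K ^ 2 * sin p.1 * cos p.1 ^ (K - 1) *
        (hypergeometricPolynomial n K).eval (cos p.1 ^ 2) : ℝ) =
          K ^ 2 * (sin p.1 / cos p.1) * radialPart n K p.1 := by
      rw [radialPart]
      rcases K with _ | K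
      · simp
      · rw [Nat.add_sub_cancel, pow_succ]
        field_simp
        ring
    have hs' : ((sin p.1 : ℝ) : ℂ) ≠ 0 := by exact_mod_cast hs.ne'
    have hc' : ((cos p.1 : ℝ) : ℂ) ≠ 0 := by exact_mod_cast hc.ne'
    simp only [hG, hJ, hS]
    rw [coordLaplacian_eq, tan_eq_sin_div_cos, grushinEigenvalue_eq, hk2, ← hK]
    -- Where `sin x < δ` the `x`-derivatives vanish, and elsewhere `max (sin x) δ = sin x`.
    rcases lt_or_ge (sin p.1) δ with h | h
    · have h0 : ∀ x, sin x < δ → ∀ φ, u (x, φ) = 0 := fun x hx φ => hu0 (x, φ) hx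
      have h1 : ∀ x, sin x < δ → ∀ φ, partialX u (x, φ) = 0 := fun x hx φ => by
        have : (fun x => u (x, φ)) =ᶠ[𝓝 x] fun _ => 0 := by
          filter_upwards [hopen.mem_nhds hx] with y hy using h0 y hy φ
        rw [partialX, this.deriv_eq, deriv_const]
      have h2 : partialX (partialX u) p = 0 := by
        have : (fun x => partialX u (x, p.2)) =ᶠ[𝓝 p.1] fun _ => 0 := by
          filter_upwards [hopen.mem_nhds h] with y hy using h1 y hy p.2
        rw [partialX, this.deriv_eq, deriv_const]
      rw [h2, show partialX u p = 0 from h1 p.1 h p.2, hu0 p h]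
      push_cast [-Complex.ofReal_sin, -Complex.ofReal_cos]
      field_simp
      ring
    · rw [max_eq_left h]
      push_cast [-Complex.ofReal_sin, -Complex.ofReal_cos]
      field_simp
      ring
  have hJi : IntegrableOn J coordRectangle := by
    refine (hint.sub hGi).congr_fun (fun p hp => ?_) measurableSet_coordRectangle
    simp only [Pi.sub_apply]
    rw [hsplit p hp]
    ring
  have hG0 : ∫ p in coordRectangle, G p = 0 := by
    rw [coordRectangle, Measure.volume_eq_prod, ← Measure.prod_restrict, integral_prod_symm]
    · refine integral_eq_zero_of_ae (Eventually.of_forall fun φ => ?_)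
      have hF : ContDiff ℝ ∞ fun x => u (x, φ) := hu.comp (contDiff_id.prodMk contDiff_const)
      have := integral_radialPart_mul_eq_zero n K hF hδ fun x hx => hu0 (x, φ) hx
      simp only [hG, Pi.zero_apply]
      rw [integral_const_mul]
      refine mul_eq_zero_of_right _ this
    · rw [Measure.prod_restrict, ← Measure.volume_eq_prod]
      exact hGi
  have hJ0 : ∫ p in coordRectangle, J p = 0 := by
    rw [coordRectangle, Measure.volume_eq_prod, ← Measure.prod_restrict, integral_prod]
    · refine integral_eq_zero_of_ae (Eventually.of_forall fun x => ?_)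
      have hF : ContDiff ℝ ∞ fun φ => u (x, φ) := hu.comp (contDiff_const.prodMk contDiff_id)
      have := integral_exp_mul_eq_zero k hF (hper x)
      simp only [hJ, Pi.zero_apply]
      rw [integral_const_mul]
      refine mul_eq_zero_of_right _ this
    · rw [Measure.prod_restrict, ← Measure.volume_eq_prod]
      exact hJi
  rw [setIntegral_congr_fun measurableSet_coordRectangle hsplit, integral_add hGi hJi, hG0, hJ0,
    add_zero]

/-- `-Δ` on test functions is contained in the maximal operator that is diagonal in the
eigenfunctions. -/
theorem inner_eigenvector_of_mem_coreGraph {n : ℕ} (hn : 1 ≤ n) (k : ℤ) {w : GrushinL2 × GrushinL2}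
    (hw : w ∈ grushinCoreGraph) : inner ℂ (eigenvector hn k) w.2 =
      (grushinEigenvalue n k : ℂ) * inner ℂ (eigenvector hn k) w.1 := by
  obtain ⟨f, hf, h1, h2⟩ := hw
  obtain ⟨δ, hδ, hfδ⟩ := hf.exists_eq_zero
  rw [← sub_eq_zero, ← inner_smul_right, ← inner_sub_right, L2.inner_def]
  set h := w.2 - (grushinEigenvalue n k : ℂ) • w.1 with hh
  set g : UnitSphere → ℂ := fun q => starRingEnd ℂ (grushinEigenfunction n k q) *
    -(grushinLaplacianFun f q + (grushinEigenvalue n k : ℂ) * f q) with hg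
  have hae : (fun q => inner ℂ (eigenvector hn k q) (h q)) =ᵐ[grushinVolume] g := by
    filter_upwards [coeFn_eigenvector hn k, h1, h2, Lp.coeFn_sub w.2
      ((grushinEigenvalue n k : ℂ) • w.1), Lp.coeFn_smul (grushinEigenvalue n k : ℂ) w.1]
      with q ha hb hc hd he
    rw [RCLike.inner_apply, ha, hh, hd, Pi.sub_apply, hc, he, Pi.smul_apply, hb, smul_eq_mul]
    simp only [hg]
    ring
  have hgi : Integrable g grushinVolume :=
    (L2.integrable_inner (𝕜 := ℂ) (eigenvector hn k) h).congr hae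
  rw [integral_congr_ae hae, integral_grushinVolume hgi.aestronglyMeasurable]
  have hgi' := (integrable_grushinVolume_iff hgi.aestronglyMeasurable).1 hgi
  set u : ℝ × ℝ → ℂ := fun p => f (sphericalPoint p) with hu
  set c : ℂ := -Complex.exp (-(Complex.I * k * (π / 2))) with hc
  have hc0 : c ≠ 0 := neg_ne_zero.2 (Complex.exp_ne_zero _)
  have hcoord : ∀ p ∈ coordRectangle, (1 / |tan p.1|) • g (sphericalPoint p) =
      c * (Complex.exp (-(Complex.I * k * p.2)) *
      (((cos p.1 / sin p.1 : ℝ) : ℂ) * (radialPart n k.natAbs p.1 : ℂ) *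
        (coordLaplacian u p + (grushinEigenvalue n k : ℂ) * u p))) := by
    intro p hp
    have hs : 0 < sin p.1 := sin_pos_of_pos_of_lt_pi hp.1.1 (by linarith [hp.1.2, pi_pos])
    have hcos : 0 < cos p.1 := cos_pos_of_mem_Ioo ⟨by linarith [hp.1.1, pi_pos], hp.1.2⟩
    have hexp : starRingEnd ℂ (Complex.exp (Complex.I * k * (p.2 + π / 2))) =
        Complex.exp (-(Complex.I * k * (π / 2))) * Complex.exp (-(Complex.I * k * p.2)) := by
      rw [← Complex.exp_conj, ← Complex.exp_add]
      congr 1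
      have h2 : starRingEnd ℂ (2 : ℂ) = 2 := map_ofNat _ 2
      simp [h2]
      ring
    simp only [hg, hu, hc]
    rw [grushinEigenfunction_sphericalPoint n k hp, grushinLaplacianFun,
      sphericalCoord_sphericalPoint hp, tan_eq_sin_div_cos, abs_of_pos (by positivity), one_div_div,
      map_mul, hexp, Complex.conj_ofReal, Complex.real_smul]
    ring
  rw [setIntegral_congr_fun measurableSet_coordRectangle hcoord, integral_const_mul]
  refine mul_eq_zero_of_right _ (integral_eigenfunction_mul_laplacian n k hf.contDiff
    (fun x φ => congrArg f (sphericalPoint_add_two_pi x φ)) hδ (fun p hp => hfδ _ (by simpa using hp)) ?_)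
  have : IntegrableOn (fun p => c⁻¹ * _) coordRectangle :=
    (hgi'.congr_fun hcoord measurableSet_coordRectangle).const_mul c⁻¹
  refine this.congr_fun (fun p _ => ?_) measurableSet_coordRectangle
  simp only
  rw [inv_mul_cancel_left₀ hc0]

end Symmetry

/-! ### Logarithmic cutoffs -/

section Cutoff

theorem exists_deriv_smoothTransition_le : ∃ B, 0 ≤ B ∧ (∀ x, |deriv smoothTransition x| ≤ B) ∧
    ∀ x, |deriv (deriv smoothTransition) x| ≤ B := by
  have hη : ContDiff ℝ ∞ smoothTransition := smoothTransition.contDiff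
  have hη1 : ContDiff ℝ ∞ (deriv smoothTransition) := (contDiff_infty_iff_deriv.1 hη).2
  have hη2 : ContDiff ℝ ∞ (deriv (deriv smoothTransition)) := (contDiff_infty_iff_deriv.1 hη1).2
  have hsupp : HasCompactSupport (deriv smoothTransition) := by
    refine HasCompactSupport.intro (isCompact_Icc (a := (0 : ℝ)) (b := 1)) fun x hx => ?_
    rw [mem_Icc, not_and_or, not_le, not_le] at hx
    rcases hx with hx | hx
    · have : smoothTransition =ᶠ[𝓝 x] fun _ => 0 := by
        filter_upwards [Iio_mem_nhds hx] with y hy using smoothTransition.zero_of_nonpos (le_of_lt hy)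
      rw [this.deriv_eq, deriv_const]
    · have : smoothTransition =ᶠ[𝓝 x] fun _ => 1 := by
        filter_upwards [Ioi_mem_nhds hx] with y hy using smoothTransition.one_of_one_le (le_of_lt hy)
      rw [this.deriv_eq, deriv_const]
  obtain ⟨B1, h1⟩ := hsupp.exists_bound_of_continuous hη1.continuous
  obtain ⟨B2, h2⟩ := hsupp.deriv.exists_bound_of_continuous hη2.continuous
  exact ⟨max |B1| |B2|, (abs_nonneg _).trans (le_max_left _ _),
    fun x => (h1 x).trans ((le_abs_self _).trans (le_max_left _ _)),
    fun x => (h2 x).trans ((le_abs_self _).trans (le_max_right _ _))⟩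

/-- A smooth function that is `0` for `s ≤ e ^ (-2 L)` and `1` for `s ≥ e ^ (-L)`, and depends on
`log s / L` in between. (Below `e ^ (-3 L)` it is set to `0` because of the values of `log` at
negative numbers.) -/
noncomputable def logCutoff (L s : ℝ) : ℝ :=
  if s ≤ exp (-(3 * L)) then 0 else smoothTransition (2 + log s / L)

variable {L : ℝ}

theorem logCutoff_of_pos (hL : 0 < L) {s : ℝ} (hs : 0 < s) :
    logCutoff L s = smoothTransition (2 + log s / L) := by
  unfold logCutoff
  split_ifs with h
  · rw [smoothTransition.zero_of_nonpos]
    have h1 : log s ≤ -(3 * L) := by rwa [log_le_iff_le_exp hs]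
    have : log s / L ≤ -3 := by rw [div_le_iff₀ hL]; linarith
    linarith
  · rfl

theorem logCutoff_eq_zero (hL : 0 < L) {s : ℝ} (hs : s ≤ exp (-(2 * L))) : logCutoff L s = 0 := by
  rcases le_or_gt s 0 with h | h
  · exact if_pos (h.trans (exp_pos _).le)
  · rw [logCutoff_of_pos hL h, smoothTransition.zero_of_nonpos]
    have h1 : log s ≤ -(2 * L) := by rwa [log_le_iff_le_exp h]
    have : log s / L ≤ -2 := by rw [div_le_iff₀ hL]; linarith
    linarith

theorem logCutoff_eq_one (hL : 0 < L) {s : ℝ} (hs : exp (-L) ≤ s) : logCutoff L s = 1 := by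
  have h := (exp_pos _).trans_le hs
  rw [logCutoff_of_pos hL h, smoothTransition.one_of_one_le]
  have h1 : -L ≤ log s := by rwa [le_log_iff_exp_le h]
  have : -1 ≤ log s / L := by rw [le_div_iff₀ hL]; linarith
  linarith

theorem logCutoff_nonneg (L s : ℝ) : 0 ≤ logCutoff L s := by
  unfold logCutoff
  split_ifs
  · exact le_rfl
  · exact smoothTransition.nonneg _

theorem logCutoff_le_one (L s : ℝ) : logCutoff L s ≤ 1 := by
  unfold logCutoff
  split_ifs
  · exact zero_le_one
  · exact smoothTransition.le_one _

theorem contDiff_logCutoff (hL : 0 < L) : ContDiff ℝ ∞ (logCutoff L) := by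
  rw [contDiff_iff_contDiffAt]
  intro s
  rcases lt_or_ge s (exp (-(2 * L))) with h | h
  · refine contDiffAt_const (c := (0 : ℝ)) |>.congr_of_eventuallyEq ?_
    filter_upwards [Iio_mem_nhds h] with y hy using logCutoff_eq_zero hL (le_of_lt hy)
  · have hs : 0 < s := (exp_pos _).trans_le h
    have h1 : ContDiffAt ℝ ∞ (fun s => smoothTransition (2 + log s / L)) s :=
      smoothTransition.contDiff.contDiffAt.comp s
        (contDiffAt_const.add ((contDiffAt_log.2 hs.ne').div_const L))
    refine h1.congr_of_eventuallyEq ?_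
    filter_upwards [Ioi_mem_nhds hs] with y hy using logCutoff_of_pos hL hy

/-- The commutator of the radial Laplacian with a cutoff `χ(x) = η(2 + log (sin x) / L)`, applied to
the radial part of an eigenfunction, is `O(1 / L)`. -/
theorem exists_commutator_le {n : ℕ} (hn : 1 ≤ n) (K : ℕ) :
    ∃ C, 0 ≤ C ∧ ∀ L, 1 ≤ L → ∀ x ∈ Ioo 0 (π / 2),
      |deriv (deriv fun x => logCutoff L (sin x)) x * radialPart n K x
        + 2 * deriv (fun x => logCutoff L (sin x)) x * deriv (radialPart n K) x
        - 1 / (sin x * cos x) * deriv (fun x => logCutoff L (sin x)) x * radialPart n K x|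
          ≤ C / L := by
  obtain ⟨B, hB0, hB1, hB2⟩ := exists_deriv_smoothTransition_le
  set V : ℝ → ℝ := fun x => cos x ^ K * (reducedPolynomial n K).eval (cos x ^ 2) with hV
  have hVs : ContDiff ℝ ∞ V :=
    (contDiff_cos.pow K).mul ((contDiff_polynomial_eval _).comp (contDiff_cos.pow 2))
  have hV1 : ContDiff ℝ ∞ (deriv V) := (contDiff_infty_iff_deriv.1 hVs).2
  have hRV : radialPart n K = fun x => sin x ^ 2 * V x := by
    funext x
    rw [radialPart, hypergeometricPolynomial_eq hn, hV, sin_sq]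
    simp
    ring
  obtain ⟨M1, hM1⟩ := isCompact_Icc (a := (0 : ℝ)) (b := π / 2) |>.exists_bound_of_continuousOn
    hVs.continuous.continuousOn
  obtain ⟨M2, hM2⟩ := isCompact_Icc (a := (0 : ℝ)) (b := π / 2) |>.exists_bound_of_continuousOn
    hV1.continuous.continuousOn
  have hMnn : 0 ≤ M1 ∧ 0 ≤ M2 := by
    have h0 : (0 : ℝ) ∈ Icc (0 : ℝ) (π / 2) := ⟨le_rfl, by positivity⟩
    exact ⟨(norm_nonneg _).trans (hM1 0 h0), (norm_nonneg _).trans (hM2 0 h0)⟩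
  refine ⟨B * (3 * M1 + 2 * (2 * M1 + M2)), by have := hMnn.1; have := hMnn.2; positivity,
    fun L hL x hx => ?_⟩
  have hL0 : 0 < L := one_pos.trans_le hL
  have hs : 0 < sin x := sin_pos_of_pos_of_lt_pi hx.1 (by linarith [hx.2, pi_pos])
  have hc : 0 < cos x := cos_pos_of_mem_Ioo ⟨by linarith [hx.1, pi_pos], hx.2⟩
  have hη : ContDiff ℝ ∞ smoothTransition := smoothTransition.contDiff
  have hη1 : ContDiff ℝ ∞ (deriv smoothTransition) := (contDiff_infty_iff_deriv.1 hη).2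
  have harg : ∀ y, 0 < sin y → HasDerivAt (fun y => 2 + log (sin y) / L) (cos y / sin y / L) y :=
    fun y hy => (((hasDerivAt_sin y).log hy.ne').div_const L).const_add 2
  have hpos : ∀ᶠ y in 𝓝 x, 0 < sin y := continuous_sin.continuousAt.eventually (lt_mem_nhds hs)
  have hd1 : ∀ y, 0 < sin y → deriv (fun x => logCutoff L (sin x)) y =
      deriv smoothTransition (2 + log (sin y) / L) * (cos y / sin y / L) := by
    intro y hy
    have e : (fun x => logCutoff L (sin x)) =ᶠ[𝓝 y] fun x => smoothTransition (2 + log (sin x) / L) := by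
      filter_upwards [continuous_sin.continuousAt.eventually (lt_mem_nhds hy)] with z hz
      exact logCutoff_of_pos hL0 hz
    rw [e.deriv_eq]
    exact ((hη.differentiable (by simp) _).hasDerivAt.comp y (harg y hy)).deriv
  have hd2 : deriv (deriv fun x => logCutoff L (sin x)) x =
      deriv (deriv smoothTransition) (2 + log (sin x) / L) * (cos x / sin x / L) ^ 2
        - deriv smoothTransition (2 + log (sin x) / L) * (1 / sin x ^ 2 / L) := by
    have e : deriv (fun x => logCutoff L (sin x)) =ᶠ[𝓝 x] fun y =>
        deriv smoothTransition (2 + log (sin y) / L) * (cos y / sin y / L) := by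
      filter_upwards [hpos] with y hy using hd1 y hy
    rw [e.deriv_eq]
    have h1 := (hη1.differentiable (by simp) (2 + log (sin x) / L)).hasDerivAt.comp x (harg x hs)
    have h2 := ((hasDerivAt_cos x).div (hasDerivAt_sin x) hs.ne').div_const L
    refine (h1.mul h2).deriv.trans ?_
    have h3 : (-sin x * sin x - cos x * cos x) = -1 := by linarith [sin_sq_add_cos_sq x]
    rw [h3]
    simp only [Function.comp_apply, Pi.div_apply]
    ring
  have hR1 : deriv (radialPart n K) x = sin x * (2 * cos x * V x + sin x * deriv V x) := by
    rw [hRV]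
    have := ((hasDerivAt_sin x).pow 2).mul (hVs.differentiable (by simp) x).hasDerivAt
    refine this.deriv.trans ?_
    simp
    ring
  rw [hd1 x hs, hd2, hR1, hRV]
  have b1 := hB1 (2 + log (sin x) / L)
  have b2 := hB2 (2 + log (sin x) / L)
  set a := deriv smoothTransition (2 + log (sin x) / L)
  set b := deriv (deriv smoothTransition) (2 + log (sin x) / L)
  have hx' : x ∈ Icc 0 (π / 2) := ⟨hx.1.le, hx.2.le⟩
  have m1 : |V x| ≤ M1 := hM1 x hx'
  have m2 : |deriv V x| ≤ M2 := hM2 x hx'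
  -- The factor `sin² x` of `R` cancels the singularities of the coefficients at the equator.
  have e : (b * (cos x / sin x / L) ^ 2 - a * (1 / sin x ^ 2 / L)) * (sin x ^ 2 * V x) +
      2 * (a * (cos x / sin x / L)) * (sin x * (2 * cos x * V x + sin x * deriv V x)) -
      1 / (sin x * cos x) * (a * (cos x / sin x / L)) * (sin x ^ 2 * V x) =
      (b * (cos x ^ 2 * V x / L) - 2 * (a * V x)
        + 2 * (a * (cos x * (2 * cos x * V x + sin x * deriv V x)))) / L := by
    field_simp
    ring
  rw [e, abs_div, abs_of_pos hL0]
  refine div_le_div_of_nonneg_right ?_ hL0.le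
  have c1 : |cos x| ≤ 1 := abs_cos_le_one x
  have s1 : |sin x| ≤ 1 := abs_sin_le_one x
  have t1 : |b * (cos x ^ 2 * V x / L)| ≤ B * M1 := by
    rw [abs_mul, abs_div, abs_mul, abs_of_pos hL0, abs_pow]
    gcongr
    calc |cos x| ^ 2 * |V x| / L ≤ 1 ^ 2 * M1 / 1 := by
          have := hMnn.1
          gcongr
      _ = M1 := by ring
  have t2 : |2 * (a * V x)| ≤ 2 * (B * M1) := by
    rw [abs_mul, abs_mul, abs_two]
    gcongr
  have t3 : |2 * (a * (cos x * (2 * cos x * V x + sin x * deriv V x)))| ≤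
      2 * (B * (2 * M1 + M2)) := by
    rw [abs_mul, abs_mul, abs_two]
    gcongr
    calc |cos x * (2 * cos x * V x + sin x * deriv V x)|
        ≤ 1 * (2 * 1 * M1 + 1 * M2) := by
          rw [abs_mul]
          have h := abs_add_le (2 * cos x * V x) (sin x * deriv V x)
          rw [abs_mul (2 * cos x), abs_mul (sin x), abs_mul 2, abs_two] at h
          have := hMnn.1
          gcongr
          refine h.trans ?_
          gcongr
      _ = 2 * M1 + M2 := by ring
  have := abs_add_le (b * (cos x ^ 2 * V x / L) - 2 * (a * V x))
    (2 * (a * (cos x * (2 * cos x * V x + sin x * deriv V x))))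
  have := abs_sub (b * (cos x ^ 2 * V x / L)) (2 * (a * V x))
  linarith

end Cutoff

/-! ### The eigenfunctions belong to the closure -/

section Closure

/-- The Laplacian separates the variables. -/
theorem coordLaplacian_separated {u : ℝ × ℝ → ℂ} {A : ℝ → ℝ} (hA : ContDiff ℝ ∞ A) (k : ℤ)
    {p : ℝ × ℝ} (h : u =ᶠ[𝓝 p] fun p => Complex.exp (Complex.I * k * (p.2 + π / 2)) * (A p.1 : ℂ)) :
    coordLaplacian u p = Complex.exp (Complex.I * k * (p.2 + π / 2)) *
      ((deriv (deriv A) p.1 - 1 / (sin p.1 * cos p.1) * deriv A p.1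
        - k.natAbs ^ 2 * tan p.1 ^ 2 * A p.1 : ℝ) : ℂ) := by
  have hA1 : ContDiff ℝ ∞ (deriv A) := (contDiff_infty_iff_deriv.1 hA).2
  have dA : ∀ x, HasDerivAt (fun x => (A x : ℂ)) (deriv A x : ℝ) x := fun x =>
    (hA.differentiable (by simp) x).hasDerivAt.ofReal_comp
  have dA1 : ∀ x, HasDerivAt (fun x => ((deriv A x : ℝ) : ℂ)) (deriv (deriv A) x : ℝ) x := fun x =>
    (hA1.differentiable (by simp) x).hasDerivAt.ofReal_comp
  set E : ℝ → ℂ := fun φ => Complex.exp (Complex.I * k * (φ + π / 2)) with hE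
  have dE : ∀ φ, HasDerivAt E (Complex.I * k * E φ) φ := fun φ => by
    have d0 : HasDerivAt (fun φ : ℝ => Complex.I * k * ((φ : ℂ) + π / 2)) (Complex.I * k) φ :=
      (((hasDerivAt_id φ).ofReal_comp.add_const ((π : ℂ) / 2)).const_mul
        (Complex.I * (k : ℂ))).congr_deriv (by simp)
    exact d0.cexp.congr_deriv (mul_comm _ _)
  have ex : (fun x => u (x, p.2)) =ᶠ[𝓝 p.1] fun x => E p.2 * (A x : ℂ) :=
    (Continuous.prodMk_left p.2).continuousAt.eventually h
  have ep : (fun φ => u (p.1, φ)) =ᶠ[𝓝 p.2] fun φ => E φ * (A p.1 : ℂ) :=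
    (Continuous.prodMk_right p.1).continuousAt.eventually h
  have x1 : deriv (fun x => E p.2 * (A x : ℂ)) = fun x => E p.2 * ((deriv A x : ℝ) : ℂ) :=
    funext fun x => ((dA x).const_mul _).deriv
  have p1 : deriv (fun φ => E φ * (A p.1 : ℂ)) = fun φ => (Complex.I * k) * (E φ * (A p.1 : ℂ)) :=
    funext fun φ => by rw [((dE φ).mul_const _).deriv]; ring
  have hk2 : ((k : ℂ)) ^ 2 = (k.natAbs : ℂ) ^ 2 := by
    have := (Int.natAbs_sq k).symm
    generalize k.natAbs = K at this
    exact_mod_cast this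
  rw [coordLaplacian, ex.iteratedDeriv_eq, ep.iteratedDeriv_eq, ex.deriv_eq, iteratedDeriv_succ,
    iteratedDeriv_one, iteratedDeriv_succ, iteratedDeriv_one, x1, p1,
    ((dA1 p.1).const_mul _).deriv, (((dE p.2).mul_const _).const_mul _).deriv]
  have : Complex.exp (Complex.I * k * (p.2 + π / 2)) = E p.2 := rfl
  rw [this]
  push_cast
  linear_combination (Complex.tan p.1 ^ 2 * E p.2 * (A p.1 : ℂ)) *
    ((k : ℂ) ^ 2 * Complex.I_sq - hk2)

/-- The eigenfunction `ψ_{n,k}`, cut off near the equator. -/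
noncomputable def cutoffEigenfunction (n : ℕ) (k : ℤ) (L : ℝ) (q : UnitSphere) : ℂ :=
  (logCutoff L (height q) : ℂ) * grushinEigenfunction n k q

theorem isHemisphereTestFunction_cutoffEigenfunction (n : ℕ) (k : ℤ) {L : ℝ} (hL : 0 < L) :
    IsHemisphereTestFunction (cutoffEigenfunction n k L) := by
  constructor
  · have h1 : ContMDiff (𝓡 2) 𝓘(ℝ, ℂ) ∞ fun q => (logCutoff L (height q) : ℂ) :=
      (Complex.ofRealCLM.contDiff.comp (contDiff_logCutoff hL)).contMDiff.comp contMDiff_height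
    have h2 : ContDiff ℝ ∞ fun w : ℂ × ℂ => w.1 * w.2 := contDiff_fst.mul contDiff_snd
    exact h2.contMDiff.comp (h1.prodMk_space (contMDiff_grushinEigenfunction n k))
  · have hcl : IsClosed {q | exp (-(2 * L)) ≤ height q} :=
      isClosed_le continuous_const continuous_height
    refine (closure_minimal (fun q hq => ?_) hcl).trans fun q (hq : _ ≤ height q) =>
      (exp_pos _).trans_le hq
    by_contra h
    refine hq ?_
    rw [cutoffEigenfunction, logCutoff_eq_zero hL (not_le.1 h).le, Complex.ofReal_zero, zero_mul]

/-- The defect `-Δ (χ ψ) - λ χ ψ` of a cut-off eigenfunction. -/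
noncomputable def cutoffDefect (n : ℕ) (k : ℤ) (L : ℝ) (q : UnitSphere) : ℂ :=
  -grushinLaplacianFun (cutoffEigenfunction n k L) q
    - (grushinEigenvalue n k : ℂ) * cutoffEigenfunction n k L q

theorem measurable_cutoffDefect (n : ℕ) (k : ℤ) {L : ℝ} (hL : 0 < L) :
    Measurable (cutoffDefect n k L) := by
  have h := isHemisphereTestFunction_cutoffEigenfunction n k hL
  exact h.measurable_grushinLaplacianFun.neg.sub
    (measurable_const.mul h.1.continuous.measurable)

theorem cutoffDefect_sphericalPoint (n : ℕ) (k : ℤ) {L : ℝ} (hL : 0 < L) {p : ℝ × ℝ}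
    (hp : p ∈ coordRectangle) : cutoffDefect n k L (sphericalPoint p) =
      -Complex.exp (Complex.I * k * (p.2 + π / 2)) *
      ((deriv (deriv fun x => logCutoff L (sin x)) p.1 * radialPart n k.natAbs p.1
        + 2 * deriv (fun x => logCutoff L (sin x)) p.1 * deriv (radialPart n k.natAbs) p.1
        - 1 / (sin p.1 * cos p.1) * deriv (fun x => logCutoff L (sin x)) p.1 *
          radialPart n k.natAbs p.1 : ℝ) : ℂ) := by
  have hopen : IsOpen coordRectangle := isOpen_Ioo.prod isOpen_Ioo
  set χ : ℝ → ℝ := fun x => logCutoff L (sin x) with hχ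
  have hχs : ContDiff ℝ ∞ χ := (contDiff_logCutoff hL).comp contDiff_sin
  have hχ1 : ContDiff ℝ ∞ (deriv χ) := (contDiff_infty_iff_deriv.1 hχs).2
  have hR := contDiff_radialPart n k.natAbs
  set R := radialPart n k.natAbs with hRdef
  have hR1 : ContDiff ℝ ∞ (deriv R) := (contDiff_infty_iff_deriv.1 hR).2
  have hloc : ∀ p' ∈ coordRectangle, cutoffEigenfunction n k L (sphericalPoint p') =
      Complex.exp (Complex.I * k * (p'.2 + π / 2)) * ((χ p'.1 * R p'.1 : ℝ) : ℂ) := by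
    intro p' hp'
    rw [cutoffEigenfunction, grushinEigenfunction_sphericalPoint n k hp', height_sphericalPoint]
    push_cast
    ring
  have hev : (fun p => cutoffEigenfunction n k L (sphericalPoint p)) =ᶠ[𝓝 p] fun p' =>
      Complex.exp (Complex.I * k * (p'.2 + π / 2)) * (((fun x => χ x * R x) p'.1 : ℝ) : ℂ) := by
    filter_upwards [hopen.mem_nhds hp] with p' hp' using hloc p' hp'
  have d1 : deriv (fun x => χ x * R x) = fun x => deriv χ x * R x + χ x * deriv R x :=
    funext fun x => ((hχs.differentiable (by simp) x).hasDerivAt.mul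
      (hR.differentiable (by simp) x).hasDerivAt).deriv
  have d2 : deriv (fun x => deriv χ x * R x + χ x * deriv R x) p.1 =
      deriv (deriv χ) p.1 * R p.1 + deriv χ p.1 * deriv R p.1 +
        (deriv χ p.1 * deriv R p.1 + χ p.1 * deriv (deriv R) p.1) :=
    (((hχ1.differentiable (by simp) p.1).hasDerivAt.mul
      (hR.differentiable (by simp) p.1).hasDerivAt).add
        ((hχs.differentiable (by simp) p.1).hasDerivAt.mul
          (hR1.differentiable (by simp) p.1).hasDerivAt)).deriv
  rw [cutoffDefect, grushinLaplacianFun, sphericalCoord_sphericalPoint hp,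
    coordLaplacian_separated (hχs.mul hR) k hev, d1, d2, hloc p hp, grushinEigenvalue_eq]
  -- The terms without derivatives of the cutoff cancel by the radial equation.
  have hode := radialPart_ode n k.natAbs hp.1
  rw [← hRdef] at hode
  have hode2 : deriv (deriv R) p.1 = 1 / (sin p.1 * cos p.1) * deriv R p.1
      + k.natAbs ^ 2 * tan p.1 ^ 2 * R p.1 - (4 * n * (n + k.natAbs)) * R p.1 := by linarith
  rw [hode2]
  push_cast
  ring

theorem exists_cutoffDefect_le {n : ℕ} (hn : 1 ≤ n) (k : ℤ) :
    ∃ C, 0 ≤ C ∧ ∀ L, 1 ≤ L → ∀ᵐ q ∂grushinVolume,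
      ‖cutoffDefect n k L q‖ ≤ C / L * ‖{q | exp (-(2 * L)) ≤ height q}.indicator
        (fun _ => (1 : ℂ)) q‖ := by
  obtain ⟨C, hC0, hC⟩ := exists_commutator_le hn k.natAbs
  refine ⟨C, hC0, fun L hL => ?_⟩
  have hL0 : 0 < L := one_pos.trans_le hL
  have hS : MeasurableSet {q | exp (-(2 * L)) ≤ height q} :=
    measurableSet_le measurable_const continuous_height.measurable
  refine ae_grushinVolume_of_ae_coord (measurableSet_le (measurable_cutoffDefect n k hL0).norm
    (((measurable_const.indicator hS).norm).const_mul _)) ?_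
  filter_upwards [ae_restrict_mem measurableSet_coordRectangle] with p hp
  have hnorm : ‖-Complex.exp (Complex.I * k * (p.2 + π / 2))‖ = 1 := by
    rw [norm_neg, Complex.norm_exp]
    have : (Complex.I * k * ((p.2 : ℂ) + π / 2)) =
        (((k : ℝ) * (p.2 + π / 2) : ℝ) : ℂ) * Complex.I := by
      push_cast
      ring
    rw [this, Complex.re_ofReal_mul, Complex.I_re, mul_zero, exp_zero]
  rw [cutoffDefect_sphericalPoint n k hL0 hp, norm_mul, hnorm, one_mul, Complex.norm_real]
  by_cases h : exp (-(2 * L)) ≤ sin p.1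
  · rw [indicator_of_mem (by simpa using h), norm_one, mul_one]
    exact hC L hL p.1 hp.1
  · rw [indicator_of_notMem (by simpa using h), norm_zero, mul_zero]
    have hopen : IsOpen {x | sin x < exp (-(2 * L))} := isOpen_lt continuous_sin continuous_const
    have z1 : ∀ x, sin x < exp (-(2 * L)) → deriv (fun x => logCutoff L (sin x)) x = 0 := by
      intro x hx
      have : (fun x => logCutoff L (sin x)) =ᶠ[𝓝 x] fun _ => 0 := by
        filter_upwards [hopen.mem_nhds hx] with y hy using logCutoff_eq_zero hL0 (le_of_lt hy)
      rw [this.deriv_eq, deriv_const]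
    have z2 : deriv (deriv fun x => logCutoff L (sin x)) p.1 = 0 := by
      have : deriv (fun x => logCutoff L (sin x)) =ᶠ[𝓝 p.1] fun _ => 0 := by
        filter_upwards [hopen.mem_nhds (not_le.1 h)] with y hy using z1 y hy
      rw [this.deriv_eq, deriv_const]
    rw [z2, z1 p.1 (not_le.1 h)]
    simp

theorem exists_cutoffEigenfunction_sub_le {n : ℕ} (hn : 1 ≤ n) (k : ℤ) :
    ∃ C, 0 ≤ C ∧ ∀ L, 1 ≤ L → ∀ᵐ q ∂grushinVolume,
      ‖cutoffEigenfunction n k L q - grushinEigenfunction n k q‖ ≤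
        C * exp (-L) * ‖(height q : ℂ)‖ := by
  obtain ⟨C, hC0, hC⟩ := exists_grushinEigenfunction_le hn k
  refine ⟨C, hC0, fun L hL => ?_⟩
  have hL0 : 0 < L := one_pos.trans_le hL
  filter_upwards [ae_height_pos] with q hq
  have e : cutoffEigenfunction n k L q - grushinEigenfunction n k q =
      ((logCutoff L (height q) - 1 : ℝ) : ℂ) * grushinEigenfunction n k q := by
    rw [cutoffEigenfunction]
    push_cast
    ring
  rw [e, norm_mul, Complex.norm_real, Complex.norm_real, Real.norm_of_nonneg hq.le]
  rcases le_or_gt (exp (-L)) (height q) with h | h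
  · rw [logCutoff_eq_one hL0 h, sub_self, norm_zero, zero_mul]
    positivity
  · have h1 : ‖logCutoff L (height q) - 1‖ ≤ 1 := by
      rw [Real.norm_eq_abs, abs_le]
      constructor <;> linarith [logCutoff_nonneg L (height q), logCutoff_le_one L (height q)]
    calc ‖logCutoff L (height q) - 1‖ * ‖grushinEigenfunction n k q‖
        ≤ 1 * (C * height q ^ 2) := by gcongr; exact hC q
      _ = C * height q * height q := by ring
      _ ≤ C * exp (-L) * height q := by gcongr

/-- The cut-off eigenfunctions approximate the eigenfunction in the graph norm. The logarithmic
profile is what makes the defect small: it is `O(1 / L)` on a set of volume `O(L)`. -/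
theorem eigenvector_mem_closure {n : ℕ} (hn : 1 ≤ n) (k : ℤ) :
    (eigenvector hn k, (grushinEigenvalue n k : ℂ) • eigenvector hn k) ∈
      grushinCoreGraph.topologicalClosure := by
  obtain ⟨C, hC0, hC⟩ := exists_cutoffDefect_le hn k
  obtain ⟨C', hC0', hC'⟩ := exists_cutoffEigenfunction_sub_le hn k
  set l : ℂ := (grushinEigenvalue n k : ℂ) with hl
  set h : GrushinL2 := memLp_height.toLp _ with hh
  have key : ∀ L, 1 ≤ L → ∃ w ∈ grushinCoreGraph, ‖w.1 - eigenvector hn k‖ ≤ C' * exp (-L) * ‖h‖ ∧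
      ‖w.2 - l • w.1‖ ≤ C / L * √(4 * π * L) := by
    intro L hL
    have hL0 : 0 < L := one_pos.trans_le hL
    have ht := isHemisphereTestFunction_cutoffEigenfunction n k hL0
    set S : Set UnitSphere := {q | exp (-(2 * L)) ≤ height q} with hS
    have hSm : MeasurableSet S := measurableSet_le measurable_const continuous_height.measurable
    have hSle : grushinVolume S ≤ ENNReal.ofReal (4 * π * L) := by
      refine (grushinVolume_le (exp_pos _) (exp_le_one_iff.2 (by linarith))).trans (le_of_eq ?_)
      rw [log_exp]
      congr 1
      ring
    have hSfin : grushinVolume S ≠ ⊤ := (hSle.trans_lt ENNReal.ofReal_lt_top).ne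
    have m0 : MemLp (fun q => cutoffEigenfunction n k L q - grushinEigenfunction n k q) 2
        grushinVolume :=
      memLp_height.of_le_mul (c := C' * exp (-L)) (ht.1.continuous.sub
        (contMDiff_grushinEigenfunction n k).continuous).aestronglyMeasurable (hC' L hL)
    have m1 : MemLp (cutoffEigenfunction n k L) 2 grushinVolume := by
      refine (m0.add (memLp_grushinEigenfunction hn k)).ae_eq (Eventually.of_forall fun q => ?_)
      simp
    have m2 : MemLp (cutoffDefect n k L) 2 grushinVolume :=
      (memLp_indicator_const 2 hSm (1 : ℂ) (Or.inr hSfin)).of_le_mul (c := C / L)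
        (measurable_cutoffDefect n k hL0).aestronglyMeasurable (hC L hL)
    have m3 : MemLp (fun q => -grushinLaplacianFun (cutoffEigenfunction n k L) q) 2
        grushinVolume := by
      refine (m2.add (m1.const_mul l)).ae_eq (Eventually.of_forall fun q => ?_)
      simp [cutoffDefect, hl]
    refine ⟨(m1.toLp _, m3.toLp _), ⟨_, ht, m1.coeFn_toLp, m3.coeFn_toLp⟩, ?_, ?_⟩
    · refine Lp.norm_le_mul_norm_of_ae_le_mul ?_
      filter_upwards [hC' L hL, m1.coeFn_toLp, coeFn_eigenvector hn k, memLp_height.coeFn_toLp,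
        Lp.coeFn_sub (m1.toLp _) (eigenvector hn k)] with q a b c d e
      rw [e, Pi.sub_apply, b, c, hh, d]
      exact a
    · have h1 : ‖m3.toLp _ - l • m1.toLp _‖ ≤ C / L * ‖indicatorConstLp 2 hSm hSfin (1 : ℂ)‖ := by
        refine Lp.norm_le_mul_norm_of_ae_le_mul ?_
        filter_upwards [hC L hL, m1.coeFn_toLp, m3.coeFn_toLp, Lp.coeFn_smul l (m1.toLp _),
          Lp.coeFn_sub (m3.toLp _) (l • m1.toLp _),
          indicatorConstLp_coeFn (p := 2) (hs := hSm) (hμs := hSfin) (c := (1 : ℂ))]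
          with q a b c d e f
        rw [e, Pi.sub_apply, c, d, Pi.smul_apply, b, f]
        exact a
      refine h1.trans ?_
      gcongr
      rw [norm_indicatorConstLp (by norm_num) (by norm_num), norm_one, one_mul, sqrt_eq_rpow]
      norm_num
      refine Real.rpow_le_rpow measureReal_nonneg ?_ (by norm_num)
      rw [Measure.real]
      exact ENNReal.toReal_le_of_le_ofReal (by positivity) hSle
  choose! w hw hw1 hw2 using key
  have hL : Tendsto (fun m : ℕ => (m : ℝ) + 1) atTop atTop :=
    tendsto_atTop_add_const_right _ _ tendsto_natCast_atTop_atTop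
  have hL1 : ∀ m : ℕ, (1 : ℝ) ≤ (m : ℝ) + 1 := fun m => by linarith [m.cast_nonneg (α := ℝ)]
  have t1 : Tendsto (fun m : ℕ => (w (m + 1)).1) atTop (𝓝 (eigenvector hn k)) := by
    rw [tendsto_iff_norm_sub_tendsto_zero]
    refine squeeze_zero (fun _ => norm_nonneg _) (fun m => hw1 _ (hL1 m)) ?_
    have := (tendsto_exp_neg_atTop_nhds_zero.comp hL).const_mul C'
    simpa using this.mul_const ‖h‖
  have t2 : Tendsto (fun m : ℕ => (w (m + 1)).2 - l • (w (m + 1)).1) atTop (𝓝 0) := by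
    rw [tendsto_zero_iff_norm_tendsto_zero]
    refine squeeze_zero (fun _ => norm_nonneg _) (fun m => hw2 _ (hL1 m)) ?_
    have e : ∀ m : ℕ, C / ((m : ℝ) + 1) * √(4 * π * ((m : ℝ) + 1)) =
        C * √(4 * π) * (√((m : ℝ) + 1))⁻¹ := by
      intro m
      have h0 : (0 : ℝ) < (m : ℝ) + 1 := by positivity
      have h1 : √((m : ℝ) + 1) ≠ 0 := (sqrt_pos.2 h0).ne'
      rw [sqrt_mul (by positivity)]
      have h2 : √((m : ℝ) + 1) * √((m : ℝ) + 1) = (m : ℝ) + 1 := mul_self_sqrt h0.le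
      field_simp
      rw [sq, h2]
    simp only [e]
    have := (tendsto_inv_atTop_zero.comp (tendsto_sqrt_atTop.comp hL)).const_mul (C * √(4 * π))
    simpa using this
  have t3 : Tendsto (fun m : ℕ => (w (m + 1)).2) atTop (𝓝 (l • eigenvector hn k)) := by
    have := t2.add (t1.const_smul l)
    simpa using this
  exact mem_closure_of_tendsto (t1.prodMk_nhds t3) (Eventually.of_forall fun m => hw _ (hL1 m))

end Closure

/-! ### Totality of the eigenfunctions -/

section Totality

variable {h : GrushinL2}

theorem integrable_height_sq_mul (h : GrushinL2) :
    Integrable (fun q => ((height q ^ 2 : ℝ) : ℂ) * h q) grushinVolume := by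
  have h1 : Integrable (fun q => (height q : ℂ) * h q) grushinVolume :=
    memLp_height.integrable_mul (Lp.memLp h)
  have hc : Continuous fun q => (height q : ℂ) := Complex.continuous_ofReal.comp continuous_height
  have h2 := h1.bdd_mul (c := 1) hc.aestronglyMeasurable (Eventually.of_forall fun q => by
    rw [Complex.norm_real, Real.norm_eq_abs]
    exact (sq_le_one_iff_abs_le_one _).1 (height_sq_le q))
  refine h2.congr (Eventually.of_forall fun q => ?_)
  simp only
  push_cast
  ring

theorem integrable_continuous_mul {g : UnitSphere → ℂ} (hg : Continuous g) {κ : UnitSphere → ℂ}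
    (hκ : Integrable κ grushinVolume) : Integrable (fun q => g q * κ q) grushinVolume := by
  obtain ⟨C, -, hC⟩ := exists_norm_le_of_continuous hg
  exact hκ.bdd_mul hg.aestronglyMeasurable (Eventually.of_forall hC)

/-- For fixed `k`, the functions `ψ_{n,k} / sin² x` span all products of the harmonic monomial with a
polynomial in `cos² x`, by the degrees of the reduced polynomials. -/
theorem integral_harmonicMonomial_mul_eq_zero (k : ℤ)
    (hh : ∀ m : ℕ, inner ℂ (eigenvector (Nat.le_add_left 1 m) k) h = 0) (p : Polynomial ℝ) :
    ∫ q, starRingEnd ℂ (harmonicMonomial k (diskPoint q)) * (p.eval (1 - height q ^ 2) : ℝ) *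
      (((height q ^ 2 : ℝ) : ℂ) * h q) ∂grushinVolume = 0 := by
  have hZ : Continuous fun q => starRingEnd ℂ (harmonicMonomial k (diskPoint q)) :=
    Complex.continuous_conj.comp
      ((contDiff_harmonicMonomial k).continuous.comp continuous_diskPoint)
  have hP : ∀ p : Polynomial ℝ, Continuous fun q => ((p.eval (1 - height q ^ 2) : ℝ) : ℂ) :=
    fun p => Complex.continuous_ofReal.comp
      (p.continuous.comp (continuous_const.sub (continuous_height.pow 2)))
  have hI : ∀ p : Polynomial ℝ, Integrable (fun q =>
      starRingEnd ℂ (harmonicMonomial k (diskPoint q)) * (p.eval (1 - height q ^ 2) : ℝ) *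
        (((height q ^ 2 : ℝ) : ℂ) * h q)) grushinVolume :=
    fun p => integrable_continuous_mul (hZ.mul (hP p)) (integrable_height_sq_mul h)
  let Λ : Polynomial ℝ →ₗ[ℝ] ℂ :=
    { toFun := fun p => ∫ q, starRingEnd ℂ (harmonicMonomial k (diskPoint q)) *
        (p.eval (1 - height q ^ 2) : ℝ) * (((height q ^ 2 : ℝ) : ℂ) * h q) ∂grushinVolume
      map_add' := fun p p' => by
        rw [← integral_add (hI p) (hI p')]
        congr 1
        funext q
        rw [Polynomial.eval_add]
        push_cast
        ring
      map_smul' := fun c p => by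
        rw [RingHom.id_apply, ← integral_smul]
        congr 1
        funext q
        rw [Polynomial.eval_smul, Complex.real_smul, smul_eq_mul]
        push_cast
        ring }
  have hΛ : Λ = 0 := by
    refine LinearMap.ext_on_range (span_reducedPolynomial k.natAbs) fun m => ?_
    have h1 := hh m
    rw [L2.inner_def] at h1
    set c : ℂ := starRingEnd ℂ (Complex.exp (Complex.I * k * (π / 2))) with hc
    have hc0 : c ≠ 0 := by
      rw [hc, Ne, map_eq_zero]
      exact Complex.exp_ne_zero _
    have h2 : ∫ q, inner ℂ (eigenvector (Nat.le_add_left 1 m) k q) (h q) ∂grushinVolume =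
        c * Λ (reducedPolynomial (m + 1) k.natAbs) := by
      change _ = c * ∫ q, _ ∂grushinVolume
      rw [← integral_const_mul]
      refine integral_congr_ae ?_
      filter_upwards [coeFn_eigenvector (Nat.le_add_left 1 m) k] with q hq
      rw [RCLike.inner_apply, hq, grushinEigenfunction_eq,
        hypergeometricPolynomial_eq (Nat.le_add_left 1 m), map_mul, map_mul, Complex.conj_ofReal, ← hc]
      simp
      ring
    rw [h2] at h1
    simpa using (mul_eq_zero.1 h1).resolve_left hc0
  exact LinearMap.congr_fun hΛ p

theorem integral_monomial_mul_eq_zero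
    (hh : ∀ (m : ℕ) (k : ℤ), inner ℂ (eigenvector (Nat.le_add_left 1 m) k) h = 0) (a b : ℕ) :
    ∫ q, diskPoint q ^ a * starRingEnd ℂ (diskPoint q) ^ b *
      (((height q ^ 2 : ℝ) : ℂ) * h q) ∂grushinVolume = 0 := by
  have hz : ∀ q, diskPoint q * starRingEnd ℂ (diskPoint q) = ((1 - height q ^ 2 : ℝ) : ℂ) := by
    intro q
    rw [Complex.mul_conj, Complex.normSq_eq_norm_sq, normSq_diskPoint]
  -- The monomial is a power of `|z|² = 1 - height²` times a power of `z` or of its conjugate.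
  rcases le_total a b with hab | hab
  · obtain ⟨d, rfl⟩ := Nat.exists_eq_add_of_le hab
    rw [← integral_harmonicMonomial_mul_eq_zero (d : ℤ) (fun m => hh m d) (Polynomial.X ^ a)]
    congr 1
    funext q
    have := hz q
    simp only [harmonicMonomial, Nat.cast_nonneg, if_true, Int.natAbs_natCast, map_pow,
      Polynomial.eval_pow, Polynomial.eval_X]
    rw [Complex.ofReal_pow (1 - height q ^ 2) a, ← hz]
    ring
  · obtain ⟨d, rfl⟩ := Nat.exists_eq_add_of_le hab
    rw [← integral_harmonicMonomial_mul_eq_zero (-(d : ℤ)) (fun m => hh m (-(d : ℤ)))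
      (Polynomial.X ^ b)]
    congr 1
    funext q
    have hZ : starRingEnd ℂ (harmonicMonomial (-(d : ℤ)) (diskPoint q)) = diskPoint q ^ d := by
      unfold harmonicMonomial
      split_ifs with hd
      · have : d = 0 := by omega
        subst this
        simp
      · simp
    rw [hZ, Polynomial.eval_pow, Polynomial.eval_X, Complex.ofReal_pow (1 - height q ^ 2) b, ← hz]
    ring

/-- The disk point as an element of the closed unit disk. -/
def diskMap (q : UnitSphere) : Metric.closedBall (0 : ℂ) 1 :=
  ⟨diskPoint q, by
    rw [mem_closedBall_zero_iff, ← sq_le_one_iff₀ (norm_nonneg _), normSq_diskPoint]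
    linarith [sq_nonneg (height q)]⟩

theorem continuous_diskMap : Continuous diskMap := continuous_diskPoint.subtype_mk _

/-- Polynomials in `z` and its conjugate are dense in the continuous functions on the closed unit disk,
by the Stone-Weierstrass theorem. -/
theorem integral_continuous_mul_eq_zero
    (hh : ∀ (m : ℕ) (k : ℤ), inner ℂ (eigenvector (Nat.le_add_left 1 m) k) h = 0)
    (g : C(Metric.closedBall (0 : ℂ) 1, ℂ)) :
    ∫ q, g (diskMap q) * (((height q ^ 2 : ℝ) : ℂ) * h q) ∂grushinVolume = 0 := by
  set κ : UnitSphere → ℂ := fun q => ((height q ^ 2 : ℝ) : ℂ) * h q with hκ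
  have hκi : Integrable κ grushinVolume := integrable_height_sq_mul h
  have hI : ∀ g : C(Metric.closedBall (0 : ℂ) 1, ℂ),
      Integrable (fun q => g (diskMap q) * κ q) grushinVolume := fun g =>
    integrable_continuous_mul (g.continuous.comp continuous_diskMap) hκi
  let Λ₀ : C(Metric.closedBall (0 : ℂ) 1, ℂ) →ₗ[ℂ] ℂ :=
    { toFun := fun g => ∫ q, g (diskMap q) * κ q ∂grushinVolume
      map_add' := fun g g' => by
        rw [← integral_add (hI g) (hI g')]
        congr 1
        funext q
        rw [ContinuousMap.add_apply, add_mul]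
      map_smul' := fun c g => by
        rw [RingHom.id_apply, ← integral_smul]
        congr 1
        funext q
        rw [ContinuousMap.smul_apply, smul_eq_mul, smul_eq_mul, mul_assoc] }
  let Λ : C(Metric.closedBall (0 : ℂ) 1, ℂ) →L[ℂ] ℂ :=
    Λ₀.mkContinuous (∫ q, ‖κ q‖ ∂grushinVolume) fun g => by
      rw [mul_comm, ← integral_const_mul]
      refine norm_integral_le_of_norm_le (hκi.norm.const_mul _) (Eventually.of_forall fun q => ?_)
      rw [norm_mul]
      exact mul_le_mul_of_nonneg_right (g.norm_coe_le_norm _) (norm_nonneg _)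
  have hker : IsClosed (LinearMap.ker Λ.toLinearMap : Set C(Metric.closedBall (0 : ℂ) 1, ℂ)) := Λ.isClosed_ker
  suffices hg : g ∈ (LinearMap.ker Λ.toLinearMap : Set C(Metric.closedBall (0 : ℂ) 1, ℂ)) from hg
  have htop := polynomialFunctions.starClosure_topologicalClosure (Metric.closedBall (0 : ℂ) 1)
  have hmem : g ∈ (polynomialFunctions (Metric.closedBall (0 : ℂ) 1)).starClosure.topologicalClosure := by
    rw [htop]
    trivial
  refine closure_minimal ?_ hker hmem
  rw [polynomialFunctions.starClosure_eq_adjoin_X]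
  intro f hf
  have hf' : f ∈ Submodule.span ℂ (Submonoid.closure
      ({Polynomial.X.toContinuousMapOn (Metric.closedBall (0 : ℂ) 1)} ∪
        star {Polynomial.X.toContinuousMapOn (Metric.closedBall (0 : ℂ) 1)} :
          Set C(Metric.closedBall (0 : ℂ) 1, ℂ)) : Set C(Metric.closedBall (0 : ℂ) 1, ℂ)) := by
    rw [← Algebra.adjoin_eq_span]
    exact hf
  refine Submodule.span_le.2 ?_ hf'
  intro e he
  rw [Set.star_singleton, Set.singleton_union] at he
  obtain ⟨a, b, rfl⟩ := (Submonoid.mem_closure_pair _ _ _).1 he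
  rw [SetLike.mem_coe, LinearMap.mem_ker]
  refine Eq.trans ?_ (integral_monomial_mul_eq_zero hh a b)
  change ∫ q, _ ∂grushinVolume = _
  congr 1
  funext q
  simp [hκ, diskMap]

/-- The point of the closed north hemisphere over a point of the closed unit disk. -/
noncomputable def liftDisk (z : Metric.closedBall (0 : ℂ) 1) : UnitSphere :=
  ⟨!₂[(z : ℂ).re, (z : ℂ).im, √(1 - ‖(z : ℂ)‖ ^ 2)], by
    have hz : ‖(z : ℂ)‖ ≤ 1 := mem_closedBall_zero_iff.1 z.2
    rw [mem_sphere_zero_iff_norm, EuclideanSpace.norm_eq, Real.sqrt_eq_one]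
    simp only [Fin.sum_univ_three, Real.norm_eq_abs, sq_abs]
    have h1 : 0 ≤ 1 - ‖(z : ℂ)‖ ^ 2 := by nlinarith [norm_nonneg (z : ℂ)]
    have h2 : ‖(z : ℂ)‖ ^ 2 = (z : ℂ).re * (z : ℂ).re + (z : ℂ).im * (z : ℂ).im := by
      rw [← Complex.normSq_eq_norm_sq, Complex.normSq_apply]
    simp [sq_sqrt h1]
    linarith⟩

theorem continuous_liftDisk : Continuous liftDisk := by
  refine Continuous.subtype_mk ((PiLp.continuous_toLp 2 _).comp (continuous_pi fun i => ?_)) _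
  have h1 := Complex.continuous_re
  have h2 := Complex.continuous_im
  fin_cases i
  · exact h1.comp continuous_subtype_val
  · exact h2.comp continuous_subtype_val
  · exact continuous_sqrt.comp (continuous_const.sub (continuous_subtype_val.norm.pow 2))

theorem liftDisk_diskMap {q : UnitSphere} (hq : 0 < height q) : liftDisk (diskMap q) = q := by
  apply Subtype.ext
  have h := normSq_diskPoint q
  have h2 : √(1 - ‖diskPoint q‖ ^ 2) = height q := by
    rw [h, sub_sub_cancel, sqrt_sq hq.le]
  ext i
  fin_cases i
  · simp [liftDisk, diskMap, diskPoint]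
  · simp [liftDisk, diskMap, diskPoint]
  · simpa [liftDisk, diskMap, height] using h2

/-- The eigenfunctions are total in `L²(S₊, dω)`. -/
theorem eq_zero_of_inner_eigenvector_eq_zero
    (hh : ∀ (m : ℕ) (k : ℤ), inner ℂ (eigenvector (Nat.le_add_left 1 m) k) h = 0) : h = 0 := by
  have := Fact.mk (@finrank_euclideanSpace_fin ℝ _ 3)
  have hκ : ∀ᵐ q ∂grushinVolume, ((height q ^ 2 : ℝ) : ℂ) * h q = 0 := by
    refine ae_eq_zero_of_integral_contMDiff_smul_eq_zero (𝓡 2)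
      (integrable_height_sq_mul h).locallyIntegrable fun g hg _ => ?_
    -- Almost everywhere the height is positive, so that `g` is a function of the disk point.
    let G : C(Metric.closedBall (0 : ℂ) 1, ℂ) :=
      ⟨fun z => (g (liftDisk z) : ℂ),
        Complex.continuous_ofReal.comp (hg.continuous.comp continuous_liftDisk)⟩
    rw [← integral_continuous_mul_eq_zero hh G]
    refine integral_congr_ae ?_
    filter_upwards [ae_height_pos] with q hq
    rw [Complex.real_smul]
    congr 2
    exact congrArg g (liftDisk_diskMap hq).symm
  refine Lp.ext ?_
  filter_upwards [hκ, ae_height_pos, Lp.coeFn_zero ℂ 2 grushinVolume] with q h1 h2 h3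
  rw [h3, Pi.zero_apply]
  refine (mul_eq_zero.1 h1).resolve_left ?_
  exact_mod_cast (pow_pos h2 2).ne'

end Totality

/-! ### Orthogonality and the spectral decomposition -/

section Decomposition

theorem integral_exp_int_mul {j : ℤ} (hj : j ≠ 0) :
    ∫ φ in Ioo (-π) π, Complex.exp (Complex.I * j * φ) = 0 := by
  have hc : Complex.I * (j : ℂ) ≠ 0 := mul_ne_zero Complex.I_ne_zero (by exact_mod_cast hj)
  rw [← integral_Ioc_eq_integral_Ioo, ← intervalIntegral.integral_of_le (by linarith [pi_pos]),
    integral_exp_mul_complex hc]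
  have : Complex.I * (j : ℂ) * (π : ℝ) =
      Complex.I * (j : ℂ) * ((-π : ℝ) : ℂ) + (j : ℂ) * (2 * π * Complex.I) := by
    push_cast
    ring
  rw [this, Complex.exp_periodic.int_mul j, sub_self, zero_div]

theorem inner_eigenvector_eq_zero_of_ne_frequency {n n' : ℕ} (hn : 1 ≤ n) (hn' : 1 ≤ n') {k k' : ℤ}
    (hk : k ≠ k') : inner ℂ (eigenvector hn k) (eigenvector hn' k') = 0 := by
  rw [L2.inner_def]
  have hae : (fun q => inner ℂ (eigenvector hn k q) (eigenvector hn' k' q)) =ᵐ[grushinVolume]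
      fun q => grushinEigenfunction n' k' q * starRingEnd ℂ (grushinEigenfunction n k q) := by
    filter_upwards [coeFn_eigenvector hn k, coeFn_eigenvector hn' k'] with q h1 h2
    rw [RCLike.inner_apply, h1, h2]
  have hc : Continuous fun q =>
      grushinEigenfunction n' k' q * starRingEnd ℂ (grushinEigenfunction n k q) :=
    (contMDiff_grushinEigenfunction n' k').continuous.mul
      (Complex.continuous_conj.comp (contMDiff_grushinEigenfunction n k).continuous)
  rw [integral_congr_ae hae, integral_grushinVolume hc.aestronglyMeasurable]
  set A : ℝ → ℂ := fun x =>
    ((1 / |tan x| * radialPart n' k'.natAbs x * radialPart n k.natAbs x : ℝ) : ℂ) *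
      Complex.exp (Complex.I * ((k' - k : ℤ) : ℂ) * (π / 2)) with hA
  set B : ℝ → ℂ := fun φ => Complex.exp (Complex.I * ((k' - k : ℤ) : ℂ) * φ) with hB
  have hprod : ∀ p ∈ coordRectangle, (1 / |tan p.1|) •
      (grushinEigenfunction n' k' (sphericalPoint p) *
        starRingEnd ℂ (grushinEigenfunction n k (sphericalPoint p))) = A p.1 * B p.2 := by
    intro p hp
    have h2 : starRingEnd ℂ (2 : ℂ) = 2 := map_ofNat _ 2
    have e : Complex.exp (Complex.I * k' * (p.2 + π / 2)) *
        starRingEnd ℂ (Complex.exp (Complex.I * k * (p.2 + π / 2))) =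
        Complex.exp (Complex.I * ((k' - k : ℤ) : ℂ) * (π / 2)) *
          Complex.exp (Complex.I * ((k' - k : ℤ) : ℂ) * p.2) := by
      rw [← Complex.exp_conj, ← Complex.exp_add, ← Complex.exp_add]
      congr 1
      simp [h2]
      ring
    rw [grushinEigenfunction_sphericalPoint n' k' hp, grushinEigenfunction_sphericalPoint n k hp,
      map_mul, Complex.conj_ofReal, Complex.real_smul]
    simp only [hA, hB]
    push_cast [-Int.cast_sub]
    linear_combination (1 / ((|tan p.1| : ℝ) : ℂ)) * (radialPart n' k'.natAbs p.1 : ℂ) *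
      (radialPart n k.natAbs p.1 : ℂ) * e
  rw [setIntegral_congr_fun measurableSet_coordRectangle hprod, coordRectangle,
    Measure.volume_eq_prod, setIntegral_prod_mul A B]
  refine mul_eq_zero_of_right _ (integral_exp_int_mul (sub_ne_zero.2 hk.symm))

theorem isClosed_setOf_inner_eq {n : ℕ} (hn : 1 ≤ n) (k : ℤ) :
    IsClosed {w : GrushinL2 × GrushinL2 | inner ℂ (eigenvector hn k) w.2 =
      (grushinEigenvalue n k : ℂ) * inner ℂ (eigenvector hn k) w.1} :=
  isClosed_eq (continuous_const.inner continuous_snd)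
    (continuous_const.mul (continuous_const.inner continuous_fst))

theorem inner_eigenvector_of_mem_closure {n : ℕ} (hn : 1 ≤ n) (k : ℤ) {w : GrushinL2 × GrushinL2}
    (hw : w ∈ grushinCoreGraph.topologicalClosure) : inner ℂ (eigenvector hn k) w.2 =
      (grushinEigenvalue n k : ℂ) * inner ℂ (eigenvector hn k) w.1 :=
  closure_minimal (fun _ hw => inner_eigenvector_of_mem_coreGraph hn k hw)
    (isClosed_setOf_inner_eq hn k) hw

theorem grushinEigenvalue_injective {n n' : ℕ} (hn : 1 ≤ n) {k : ℤ}
    (h : grushinEigenvalue n k = grushinEigenvalue n' k) : n = n' := by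
  rw [grushinEigenvalue_eq, grushinEigenvalue_eq] at h
  have h1 : ((n : ℝ) - n') * (n + n' + k.natAbs) = 0 := by linear_combination h / 4
  have h2 : (0 : ℝ) < n := by exact_mod_cast hn
  have h3 : (n : ℝ) + n' + k.natAbs ≠ 0 := by positivity
  exact_mod_cast sub_eq_zero.1 ((mul_eq_zero.1 h1).resolve_right h3)

theorem inner_eigenvector_eq_zero {n n' : ℕ} (hn : 1 ≤ n) (hn' : 1 ≤ n') {k k' : ℤ}
    (h : (n, k) ≠ (n', k')) : inner ℂ (eigenvector hn k) (eigenvector hn' k') = 0 := by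
  by_cases hk : k = k'
  · subst hk
    have h1 := inner_eigenvector_of_mem_closure hn k (eigenvector_mem_closure hn' k)
    simp only [inner_smul_right] at h1
    by_contra h0
    have h2 := mul_right_cancel₀ h0 h1
    exact h (by rw [grushinEigenvalue_injective hn (Complex.ofReal_injective h2).symm])
  · exact inner_eigenvector_eq_zero_of_ne_frequency hn hn' hk

/-- The normalized eigenvector; the index `(m, k)` stands for `ψ_{m+1,k}`. -/
noncomputable def normalizedEigenvector (i : ℕ × ℤ) : GrushinL2 :=
  ((‖eigenvector (Nat.le_add_left 1 i.1) i.2‖⁻¹ : ℝ) : ℂ) • eigenvector (Nat.le_add_left 1 i.1) i.2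

theorem normalization_ne_zero (i : ℕ × ℤ) :
    ((‖eigenvector (Nat.le_add_left 1 i.1) i.2‖⁻¹ : ℝ) : ℂ) ≠ 0 := by
  rw [Ne, Complex.ofReal_eq_zero, inv_eq_zero, norm_eq_zero]
  exact eigenvector_ne_zero _ _

theorem orthonormal_normalizedEigenvector : Orthonormal ℂ normalizedEigenvector := by
  constructor
  · intro i
    rw [normalizedEigenvector, norm_smul, Complex.norm_real, norm_inv, norm_norm,
      inv_mul_cancel₀ (norm_ne_zero_iff.2 (eigenvector_ne_zero _ _))]
  · intro i j hij
    rw [normalizedEigenvector, normalizedEigenvector, inner_smul_left, inner_smul_right,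
      inner_eigenvector_eq_zero, mul_zero, mul_zero]
    intro h
    exact hij (Prod.ext (by simpa using congrArg Prod.fst h) (by simpa using congrArg Prod.snd h))

theorem orthogonal_span_normalizedEigenvector :
    (Submodule.span ℂ (range normalizedEigenvector))ᗮ = ⊥ := by
  rw [Submodule.eq_bot_iff]
  intro h hh
  refine eq_zero_of_inner_eigenvector_eq_zero fun m k => ?_
  have h1 := (Submodule.mem_orthogonal _ _).1 hh _ (Submodule.subset_span ⟨(m, k), rfl⟩)
  rw [normalizedEigenvector, inner_smul_left] at h1
  refine (mul_eq_zero.1 h1).resolve_left ?_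
  rw [map_eq_zero]
  exact normalization_ne_zero (m, k)

/-- The Hilbert basis of normalized eigenfunctions. -/
noncomputable def eigenbasis : HilbertBasis (ℕ × ℤ) ℂ GrushinL2 :=
  HilbertBasis.mkOfOrthogonalEqBot orthonormal_normalizedEigenvector
    orthogonal_span_normalizedEigenvector

theorem eigenbasis_apply (i : ℕ × ℤ) : eigenbasis i = normalizedEigenvector i := by
  rw [eigenbasis, HilbertBasis.coe_mkOfOrthogonalEqBot]

theorem mem_closure_coreGraph_iff (w : GrushinL2 × GrushinL2) :
    w ∈ grushinCoreGraph.topologicalClosure ↔ ∀ i, inner ℂ (eigenbasis i) w.2 =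
      (grushinEigenvalue (i.1 + 1) i.2 : ℂ) * inner ℂ (eigenbasis i) w.1 := by
  constructor
  · intro hw i
    rw [eigenbasis_apply, normalizedEigenvector, inner_smul_left, inner_smul_left,
      inner_eigenvector_of_mem_closure _ _ hw]
    ring
  · intro hw
    refine eigenbasis.mem_of_inner_eq_mul (l := fun i => (grushinEigenvalue (i.1 + 1) i.2 : ℂ))
      (Submodule.isClosed_topologicalClosure _) (fun i => ?_) hw
    rw [eigenbasis_apply, normalizedEigenvector, smul_comm]
    exact Submodule.smul_mem _ _ (eigenvector_mem_closure (Nat.le_add_left 1 i.1) i.2)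

/-- The test functions give a closable operator: in the closure of its graph, all coordinates of the
second component vanish with those of the first. -/
theorem grushinOperator_graph :
    grushinOperator.graph = grushinCoreGraph.topologicalClosure := by
  have hcl : grushinCore.IsClosable := by
    refine ⟨grushinCoreGraph.topologicalClosure.toLinearPMap, ?_⟩
    rw [grushinCore_graph, Submodule.toLinearPMap_graph_eq]
    intro w hw h0
    rw [mem_closure_coreGraph_iff] at hw
    refine eigenbasis.ext_inner fun i => ?_
    rw [hw i, h0, inner_zero_right, mul_zero]
  rw [grushinOperator, ← hcl.graph_closure_eq_closure_graph, grushinCore_graph]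

theorem isDiagonalIn_grushinOperator :
    IsDiagonalIn grushinOperator eigenbasis fun i => grushinEigenvalue (i.1 + 1) i.2 := by
  intro w
  rw [grushinOperator_graph, mem_closure_coreGraph_iff]

theorem finite_grushinEigenvalue_le (M : ℝ) :
    {i : ℕ × ℤ | |grushinEigenvalue (i.1 + 1) i.2| ≤ M}.Finite := by
  obtain ⟨N, hN⟩ := exists_nat_ge M
  refine ((finite_Iic N).prod (finite_Icc (-(N : ℤ)) N)).subset ?_
  rintro ⟨m, k⟩ (h : |_| ≤ M)
  have h1 := (le_abs_self _).trans (h.trans hN)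
  simp only [grushinEigenvalue_eq] at h1
  push_cast at h1
  have h2 : 4 * (m + 1) * (m + 1 + k.natAbs) ≤ N := by exact_mod_cast h1
  have h3 : m + 1 + k.natAbs ≤ N := (Nat.le_mul_of_pos_left _ (by positivity)).trans h2
  refine ⟨?_, ?_⟩
  · simp only [mem_Iic]
    omega
  · simp only [mem_Icc]
    omega

theorem eq_eigenvector {n : ℕ} (hn : 1 ≤ n) {k : ℤ} {u : GrushinL2}
    (hu : u =ᵐ[grushinVolume] grushinEigenfunction n k) : u = eigenvector hn k :=
  Lp.ext (hu.trans (coeFn_eigenvector hn k).symm)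

end Decomposition

theorem theorem2 :
    -- `-Δ` on `C_c^∞(S₊)` is essentially self-adjoint
    IsSelfAdjoint grushinOperator ∧
    -- the spectrum, and its pure discreteness
    operatorSpectrum grushinOperator =
      {z : ℂ | ∃ (n : ℕ) (k : ℤ), 1 ≤ n ∧ z = (grushinEigenvalue n k : ℂ)} ∧
    operatorDiscreteSpectrum grushinOperator = operatorSpectrum grushinOperator ∧
    -- every `ψ_{n,k}` is an eigenfunction for `λ_{n,k}`
    (∀ (n : ℕ) (k : ℤ), 1 ≤ n → ∃ u : grushinOperator.domain,
      (u : GrushinL2) =ᵐ[grushinVolume] grushinEigenfunction n k ∧ (u : GrushinL2) ≠ 0 ∧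
        grushinOperator u = (grushinEigenvalue n k : ℂ) • (u : GrushinL2)) ∧
    -- every eigenfunction is a linear combination of the `ψ_{n,k}` with the same eigenvalue
    (∀ z : ℂ, operatorEigenspace grushinOperator z =
      Submodule.span ℂ {u : GrushinL2 | ∃ (n : ℕ) (k : ℤ), 1 ≤ n ∧
        z = (grushinEigenvalue n k : ℂ) ∧
        u =ᵐ[grushinVolume] grushinEigenfunction n k}) := by
  have hD := isDiagonalIn_grushinOperator
  refine ⟨hD.isSelfAdjoint, ?_, hD.operatorDiscreteSpectrum_eq finite_grushinEigenvalue_le, ?_, ?_⟩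
  · rw [hD.operatorSpectrum_eq finite_grushinEigenvalue_le]
    ext z
    constructor
    · rintro ⟨⟨m, k⟩, rfl⟩
      exact ⟨m + 1, k, Nat.le_add_left 1 m, rfl⟩
    · rintro ⟨n, k, hn, rfl⟩
      exact ⟨(n - 1, k), by simp only [Nat.sub_add_cancel hn]⟩
  · intro n k hn
    have hmem := eigenvector_mem_closure hn k
    rw [← grushinOperator_graph, LinearPMap.mem_graph_iff] at hmem
    obtain ⟨u, hu1, hu2⟩ := hmem
    simp only at hu1 hu2
    refine ⟨u, ?_, ?_, ?_⟩
    · rw [hu1]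
      exact coeFn_eigenvector hn k
    · rw [hu1]
      exact eigenvector_ne_zero hn k
    · rw [hu2, hu1]
  · intro z
    rw [hD.operatorEigenspace_eq (finite_setOf_eq finite_grushinEigenvalue_le z)]
    apply le_antisymm
    · rw [Submodule.span_le]
      rintro _ ⟨⟨m, k⟩, hi, rfl⟩
      rw [SetLike.mem_coe, eigenbasis_apply, normalizedEigenvector]
      exact Submodule.smul_mem _ _ (Submodule.subset_span
        ⟨m + 1, k, Nat.le_add_left 1 m, Eq.symm hi, coeFn_eigenvector _ _⟩)
    · rw [Submodule.span_le]
      rintro u ⟨n, k, hn, rfl, hu⟩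
      obtain ⟨m, rfl⟩ : ∃ m, n = m + 1 := ⟨n - 1, (Nat.sub_add_cancel hn).symm⟩
      rw [eq_eigenvector hn hu, SetLike.mem_coe]
      have hmem : eigenbasis (m, k) ∈ Submodule.span ℂ (eigenbasis ''
          {i | (grushinEigenvalue (i.1 + 1) i.2 : ℂ) = (grushinEigenvalue (m + 1) k : ℂ)}) :=
        Submodule.subset_span ⟨(m, k), rfl, rfl⟩
      rw [eigenbasis_apply, normalizedEigenvector] at hmem
      exact (Submodule.smul_mem_iff _ (normalization_ne_zero (m, k))).1 hmem
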